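/- Let $\mathfrak h$ be a real separable Hilbert space, $\mathfrak h_{\mathbb C}$ its complexification (inner products are antilinear in the first argument), and let $\mathfrak H=\bigoplus_{n\ge 0}\mathfrak h_{\mathbb C}^{\odot n}$ be the symmetric Fock space over $\mathfrak h_{\mathbb C}$, with exponential vectors $\mathcal E(k)=\sum_{n\ge 0}k^{\otimes n}/\sqrt{n!}$, $k\in\mathfrak h_{\mathbb C}$. For $h_1,h_2\in\mathfrak h$ let $U(h_1,h_2)=\exp\big(iP(h_1)+iQ(h_2)\big)$ be the unitary Weyl operator, which acts on exponential vectors, with $z=h_1+ih_2$, by $$U(h_1,h_2)\mathcal E(f)=\exp\big(-\tfrac12\|z\|^2-\langle z,f\rangle\big)\,\mathcal E(f+z)\qquad(f\in\mathfrak h_{\mathbb C}).$$ For $h=(h_1,h_2)\in\mathfrak h\otimes\mathbb R^2$, let ${\rm Dom}\,O_h$ be the set of functions $\varphi:\mathbb R^2\to\mathbb C$ for which there is a bounded operator $O_h(\varphi)\in\mathcal B(\mathfrak H)$ (necessarily unique) with $$\langle\mathcal E(k_1),O_h(\varphi)\mathcal E(k_2)\rangle=\frac1{2\pi}\int_{\mathbb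 R^2}\langle\mathcal E(k_1),U(uh_1,vh_2)\mathcal E(k_2)\rangle\,\mathcal F^{-1}\varphi(u,v)\,du\,dv\qquad\text{for all }k_1,k_2\in\mathfrak h_{\mathbb C},$$ where $\mathcal F^{-1}\varphi(u,v)=\frac1{2\pi}\int\varphi(x,y)e^{-i(ux+vy)}\,dx\,dy$. The right-hand side is understood as a distributional pairing: it is $\int\varphi\,d\nu_{k_1,k_2}$, where $\nu_{k_1,k_2}$ is the unique complex measure on $\mathbb R^2$ with $\int e^{i(ux+vy)}\,d\nu_{k_1,k_2}(x,y)=\langle\mathcal E(k_1),U(uh_1,vh_2)\mathcal E(k_2)\rangle$ for all $u,v\in\mathbb R$, and $\varphi$ is required to be integrable with respect to $|\nu_{k_1,k_2}|$ for all $k_1,k_2$. Let $\mathcal S\subseteq\mathcal B(\mathfrak H)$ be the algebra generated by all $O_h(\varphi)$ with $h\in\mathfrak h\otimes\mathbb R^2$ and $\varphi\in C^\infty(\mathbb R^2)$ such that all partial derivatives of $\varphi$, including $\varphi$ itself, lie in ${\rm Dom}\,O_h$. The algebraic tensor product $\mathcal B(\mathfrak H)\otimes\mathfrak h_{\mathbb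 C}\otimes\mathbb C^2$ is a $\mathcal B(\mathfrak H)$-bimodule through $O\cdot(O_1\otimes k)=OO_1\otimes k$ and $(O_1\otimes k)\cdot O=O_1O\otimes k$, and it is embedded in the Hilbert module $\mathfrak M=\mathcal B(\mathfrak H,\mathfrak H\otimes\mathfrak h_{\mathbb C}\otimes\mathbb C^2)$ by identifying $O\otimes k$ with the operator $v\mapsto Ov\otimes k$. **Corollary.** There is exactly one linear map $D:\mathcal S\to\mathcal B(\mathfrak H)\otimes\mathfrak h_{\mathbb C}\otimes\mathbb C^2$ which satisfies $$D\,O_h(\varphi)=\begin{pmatrix}O_h(\partial\varphi/\partial x)\otimes h_1\\ O_h(\partial\varphi/\partial y)\otimes h_2\end{pmatrix}$$ for all generators $O_h(\varphi)$ as above and $D(XY)=X\cdot D(Y)+D(X)\cdot Y$ for all $X,Y\in\mathcal S$. This derivation operator $D$, regarded as an operator with domain $\mathcal S$ from $\mathcal B(\mathfrak H)$ to $\mathfrak M$, is closable when $\mathcal B(\mathfrak H)$ and $\mathfrak M$ both carry the weak operator topology; that is, the closure of its graph in $\mathcal B(\mathfrak H)\times\mathfrak M$ is again the graph of a linear operator.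 -/

import Mathlib

open scoped TensorProduct ContDiff InnerProductSpace

noncomputable section

namespace QMalliavin

universe u

/-! ### The complexification of a real Hilbert space -/

/-- The complexification of a real Hilbert space: `⟨a, b⟩` stands for `a + i b`. -/
@[ext]
structure Cplx (𝔥 : Type u) : Type u where
  re : 𝔥
  im : 𝔥

namespace Cplx

variable {𝔥 : Type u} [NormedAddCommGroup 𝔥] [InnerProductSpace ℝ 𝔥]

set_option linter.unusedSectionVars false

instance : Zero (Cplx 𝔥) := ⟨⟨0, 0⟩⟩
instance : Add (Cplx 𝔥) := ⟨fun x y => ⟨x.re + y.re, x.im + y.im⟩⟩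
instance : Neg (Cplx 𝔥) := ⟨fun x => ⟨-x.re, -x.im⟩⟩
instance : Sub (Cplx 𝔥) := ⟨fun x y => ⟨x.re - y.re, x.im - y.im⟩⟩
instance : SMul ℂ (Cplx 𝔥) :=
  ⟨fun c x => ⟨c.re • x.re - c.im • x.im, c.re • x.im + c.im • x.re⟩⟩

@[simp] theorem zero_re : (0 : Cplx 𝔥).re = 0 := rfl
@[simp] theorem zero_im : (0 : Cplx 𝔥).im = 0 := rfl
@[simp] theorem add_re (x y : Cplx 𝔥) : (x + y).re = x.re + y.re := rfl
@[simp] theorem add_im (x y : Cplx 𝔥) : (x + y).im = x.im + y.im := rfl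
@[simp] theorem neg_re (x : Cplx 𝔥) : (-x).re = -x.re := rfl
@[simp] theorem neg_im (x : Cplx 𝔥) : (-x).im = -x.im := rfl
@[simp] theorem sub_re (x y : Cplx 𝔥) : (x - y).re = x.re - y.re := rfl
@[simp] theorem sub_im (x y : Cplx 𝔥) : (x - y).im = x.im - y.im := rfl
@[simp] theorem smul_re (c : ℂ) (x : Cplx 𝔥) : (c • x).re = c.re • x.re - c.im • x.im := rfl
@[simp] theorem smul_im (c : ℂ) (x : Cplx 𝔥) : (c • x).im = c.re • x.im + c.im • x.re := rfl

instance : AddCommGroup (Cplx 𝔥) where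
  add_assoc x y z := by ext <;> simp [add_assoc]
  zero_add x := by ext <;> simp
  add_zero x := by ext <;> simp
  add_comm x y := by ext <;> simp [add_comm]
  neg_add_cancel x := by ext <;> simp
  sub_eq_add_neg x y := by ext <;> simp [sub_eq_add_neg]
  nsmul := nsmulRec
  zsmul := zsmulRec

instance : Module ℂ (Cplx 𝔥) where
  one_smul x := by ext <;> simp
  mul_smul c d x := by
    ext
    · simp only [smul_re, smul_im, Complex.mul_re, Complex.mul_im]; module
    · simp only [smul_re, smul_im, Complex.mul_re, Complex.mul_im]; module
  smul_zero c := by ext <;> simp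
  smul_add c x y := by
    ext
    · simp only [smul_re, add_re, add_im]; module
    · simp only [smul_im, add_re, add_im]; module
  add_smul c d x := by
    ext
    · simp only [smul_re, add_re, Complex.add_re, Complex.add_im]; module
    · simp only [smul_im, add_im, Complex.add_re, Complex.add_im]; module
  zero_smul x := by ext <;> simp

/-- The sesquilinear extension of the inner product of `𝔥`, antilinear in the first argument:
`⟪a + i b, c + i d⟫ = ⟪a, c⟫ + ⟪b, d⟫ + i (⟪a, d⟫ - ⟪b, c⟫)`. -/
@[reducible]
def core : InnerProductSpace.Core ℂ (Cplx 𝔥) where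
  inner x y := ⟨inner ℝ x.re y.re + inner ℝ x.im y.im, inner ℝ x.re y.im - inner ℝ x.im y.re⟩
  conj_inner_symm x y := by
    apply Complex.ext
    · simp [real_inner_comm]
    · simp [real_inner_comm]
  re_inner_nonneg x := by
    simp only [RCLike.re_to_complex]
    exact add_nonneg real_inner_self_nonneg real_inner_self_nonneg
  add_left x y z := by
    apply Complex.ext
    · simp only [add_re, add_im, inner_add_left, Complex.add_re]; ring
    · simp only [add_re, add_im, inner_add_left, Complex.add_im]; ring
  smul_left x y c := by
    apply Complex.ext
    · simp [inner_add_left, inner_sub_left, real_inner_smul_left]; ring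
    · simp [inner_add_left, inner_sub_left, real_inner_smul_left]; ring
  definite x hx := by
    have h : inner ℝ x.re x.re + inner ℝ x.im x.im = (0 : ℝ) := congrArg Complex.re hx
    have h₁ : (0 : ℝ) ≤ inner ℝ x.re x.re := real_inner_self_nonneg
    have h₂ : (0 : ℝ) ≤ inner ℝ x.im x.im := real_inner_self_nonneg
    ext
    · exact inner_self_eq_zero (𝕜 := ℝ).1 (by linarith)
    · exact inner_self_eq_zero (𝕜 := ℝ).1 (by linarith)

instance : NormedAddCommGroup (Cplx 𝔥) := core.toNormedAddCommGroup

instance : InnerProductSpace ℂ (Cplx 𝔥) := .ofCore core.toCore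

/-- The embedding of `𝔥` into its complexification. -/
def ofReal (h : 𝔥) : Cplx 𝔥 := ⟨h, 0⟩

end Cplx

/-! ### The symmetric Fock space -/

/-- A bundled complex inner product space, used only to define tensor powers by recursion. -/
structure PreHilbert : Type (u + 1) where
  carrier : Type u
  [normed : NormedAddCommGroup carrier]
  [inner : InnerProductSpace ℂ carrier]

section Fock

variable (E : Type u) [NormedAddCommGroup E] [InnerProductSpace ℂ E]

/-- The algebraic tensor powers `E^{⊗0} = ℂ`, `E^{⊗(n+1)} = E ⊗ E^{⊗n}` with their inner product.
(The scalars appear as the one-dimensional space `EuclideanSpace ℂ PUnit` for universe reasons.) -/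
def preTensorPower : ℕ → PreHilbert.{u}
  | 0 => ⟨EuclideanSpace ℂ PUnit.{u + 1}⟩
  | n + 1 =>
    letI := (preTensorPower n).normed
    letI := (preTensorPower n).inner
    ⟨E ⊗[ℂ] (preTensorPower n).carrier⟩

/-- The algebraic `n`-fold tensor power of `E`. -/
def AlgTensorPower (n : ℕ) : Type u := (preTensorPower E n).carrier

instance (n : ℕ) : NormedAddCommGroup (AlgTensorPower E n) := (preTensorPower E n).normed

instance (n : ℕ) : InnerProductSpace ℂ (AlgTensorPower E n) := (preTensorPower E n).inner

variable {E}

/-- The tensor power `k^{⊗n} = k ⊗ ⋯ ⊗ k`. -/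
def algPow (k : E) : (n : ℕ) → AlgTensorPower E n
  | 0 => (EuclideanSpace.single PUnit.unit (1 : ℂ) : EuclideanSpace ℂ PUnit.{u + 1})
  | n + 1 => (k ⊗ₜ[ℂ] algPow k n : E ⊗[ℂ] AlgTensorPower E n)

theorem norm_algPow (k : E) (n : ℕ) : ‖algPow k n‖ = ‖k‖ ^ n := by
  induction n with
  | zero =>
    have h : ‖(EuclideanSpace.single PUnit.unit (1 : ℂ) : EuclideanSpace ℂ PUnit.{u + 1})‖ = 1 := by
      simp
    rw [pow_zero]
    exact h
  | succ n ih =>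
    have h : ‖(k ⊗ₜ[ℂ] algPow k n : E ⊗[ℂ] AlgTensorPower E n)‖ = ‖k‖ * ‖algPow k n‖ :=
      TensorProduct.norm_tmul k (algPow k n)
    rw [pow_succ', ← ih]
    exact h

variable (E)

/-- The Hilbert space tensor power: the completion of the algebraic one. -/
abbrev HilbertTensorPower (n : ℕ) : Type u := UniformSpace.Completion (AlgTensorPower E n)

/-- The `n`-fold symmetric tensor power `E^{⊙n}`, as a closed subspace of the Hilbert space tensor
power: the closed linear span of the vectors `k^{⊗n}`. -/
def symPower (n : ℕ) : Submodule ℂ (HilbertTensorPower E n) :=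
  (Submodule.span ℂ (Set.range fun k : E => (algPow k n : HilbertTensorPower E n))).topologicalClosure

/-- The symmetric Fock space `⨁ₙ E^{⊙n}` (Hilbert space direct sum). -/
abbrev Fock : Type u := lp (fun n : ℕ => symPower E n) 2

instance (n : ℕ) : CompleteSpace (symPower E n) :=
  (Submodule.isClosed_topologicalClosure _).completeSpace_coe

variable {E}

/-- The tensor power `k^{⊗n}` as an element of the symmetric tensor power. -/
def symPow (k : E) (n : ℕ) : symPower E n :=
  ⟨(algPow k n : HilbertTensorPower E n),
    Submodule.le_topologicalClosure _ (Submodule.subset_span ⟨k, rfl⟩)⟩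

theorem norm_symPow (k : E) (n : ℕ) : ‖symPow k n‖ = ‖k‖ ^ n := by
  rw [← norm_algPow k n]
  exact UniformSpace.Completion.norm_coe _

/-- The exponential vector `ℰ(k) = ∑ₙ k^{⊗n} / √(n!)`. -/
def expVec (k : E) : Fock E :=
  ⟨fun n => ((Real.sqrt (n.factorial : ℝ) : ℂ))⁻¹ • symPow k n, by
    refine memℓp_gen ?_
    have h := Real.summable_pow_div_factorial (‖k‖ ^ 2)
    refine h.congr fun n => ?_
    have h0 : (0 : ℝ) ≤ (n.factorial : ℝ) := by positivity
    rw [norm_smul, norm_symPow, norm_inv, Complex.norm_real, Real.norm_of_nonneg (Real.sqrt_nonneg _)]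
    simp only [ENNReal.toReal_ofNat, Real.rpow_ofNat]
    rw [mul_pow, inv_pow, Real.sq_sqrt h0, ← pow_mul, ← pow_mul, mul_comm n 2, div_eq_inv_mul]⟩

/-- The value `W(z) ℰ(f) = exp (-‖z‖² / 2 - ⟪z, f⟫) ℰ(f + z)` of the unitary Weyl operator
`W(z) = exp (a⁺(z) - a(z))` on an exponential vector. -/
def weylExp (z f : E) : Fock E :=
  Complex.exp (-(‖z‖ : ℂ) ^ 2 / 2 - inner ℂ z f) • expVec (f + z)

end Fock

/-! ### Weyl calculus -/

section Weyl

variable (𝔥 : Type u) [NormedAddCommGroup 𝔥] [InnerProductSpace ℝ 𝔥]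

/-- The Hilbert space of the non-commutative Wiener space over `𝔥`: the symmetric Fock space over
the complexification of `𝔥`. -/
abbrev FockSpace : Type u := Fock (Cplx 𝔥)

/-- The algebra of bounded operators on the Fock space. -/
abbrev Op : Type u := FockSpace 𝔥 →L[ℂ] FockSpace 𝔥

variable {𝔥}

/-- `U(h₁, h₂) ℰ(f)`, where `U(h₁, h₂) = exp (i P(h₁) + i Q(h₂)) = W(h₁ + i h₂)`, for `h₁, h₂`
in the real space. -/
def weylU (h₁ h₂ : 𝔥) (f : Cplx 𝔥) : FockSpace 𝔥 := weylExp (⟨h₁, h₂⟩ : Cplx 𝔥) f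

/-- The matrix element `⟪ℰ(k₁), U(u h₁, v h₂) ℰ(k₂)⟫` as a function of `(u, v)`. -/
def weylMatrix (h₁ h₂ : 𝔥) (k₁ k₂ : Cplx 𝔥) (u v : ℝ) : ℂ :=
  inner ℂ (expVec k₁) (weylU (u • h₁) (v • h₂) k₂)

/-- The complex measure `ρ μ` on `ℝ²` has the Fourier transform
`∫ exp (i (u x + v y)) d(ρ μ)(x, y) = ⟪ℰ(k₁), U(u h₁, v h₂) ℰ(k₂)⟫`. By uniqueness of Fourier
transforms there is only one such complex measure; it is `(2π)⁻¹` times the inverse Fourier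
transform (normalised as below) of the matrix element. -/
def IsInverseFourier (h₁ h₂ : 𝔥) (k₁ k₂ : Cplx 𝔥)
    (μ : MeasureTheory.Measure (ℝ × ℝ)) (ρ : ℝ × ℝ → ℂ) : Prop :=
  MeasureTheory.Integrable ρ μ ∧
    ∀ u v : ℝ, ∫ p, Complex.exp (Complex.I * ((u * p.1 + v * p.2 : ℝ) : ℂ)) * ρ p ∂μ =
      weylMatrix h₁ h₂ k₁ k₂ u v

/-- `M` is the Weyl quantization of the symbol `φ`, i.e. for all `k₁, k₂`
`⟪ℰ(k₁), M ℰ(k₂)⟫ = (2π)⁻¹ ∫ ⟪ℰ(k₁), U(u h₁, v h₂) ℰ(k₂)⟫ (𝓕⁻¹ φ)(u, v) du dv`, where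
`(𝓕⁻¹ φ)(u, v) = (2π)⁻¹ ∫ φ(x, y) exp (-i (u x + v y)) dx dy`. As `𝓕⁻¹ φ` is in general only a
distribution, the integral is a duality pairing; by the definition of the Fourier transform of
distributions it is the integral of `φ` against the inverse Fourier transform of the matrix element,
which is a complex measure `ρ μ`. -/
def IsWeylQuantization (h₁ h₂ : 𝔥) (φ : ℝ × ℝ → ℂ) (M : Op 𝔥) : Prop :=
  ∀ k₁ k₂ : Cplx 𝔥, ∃ (μ : MeasureTheory.Measure (ℝ × ℝ)) (ρ : ℝ × ℝ → ℂ),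
    IsInverseFourier h₁ h₂ k₁ k₂ μ ρ ∧
    MeasureTheory.Integrable (fun p => φ p * ρ p) μ ∧
    inner ℂ (expVec k₁) (M (expVec k₂)) = ∫ p, φ p * ρ p ∂μ

/-- The domain of the Weyl calculus `O_h`, `h = (h₁, h₂)`. -/
def weylDom (h₁ h₂ : 𝔥) : Set (ℝ × ℝ → ℂ) := {φ | ∃ M : Op 𝔥, IsWeylQuantization h₁ h₂ φ M}

open Classical in
/-- The bounded operator `O_h(φ)`, for `φ` in the domain of `O_h`. -/
def weylOp (h₁ h₂ : 𝔥) (φ : ℝ × ℝ → ℂ) : Op 𝔥 :=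
  if hφ : φ ∈ weylDom h₁ h₂ then Classical.choose hφ else 0

/-- `∂φ/∂x`. -/
def dx (φ : ℝ × ℝ → ℂ) : ℝ × ℝ → ℂ := fun p => fderiv ℝ φ p (1, 0)

/-- `∂φ/∂y`. -/
def dy (φ : ℝ × ℝ → ℂ) : ℝ × ℝ → ℂ := fun p => fderiv ℝ φ p (0, 1)

/-- `φ` is smooth and all its partial derivatives lie in the domain of `O_h`. -/
def IsSmoothSymbol (h₁ h₂ : 𝔥) (φ : ℝ × ℝ → ℂ) : Prop :=
  ContDiff ℝ ∞ φ ∧ ∀ a b : ℕ, dx^[a] (dy^[b] φ) ∈ weylDom h₁ h₂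

variable (𝔥)

/-- The algebra `𝒮` of smooth functionals, generated by the `O_h(φ)` with `φ` a smooth symbol. -/
def smoothAlgebra : Subalgebra ℂ (Op 𝔥) :=
  Algebra.adjoin ℂ {X | ∃ (h₁ h₂ : 𝔥) (φ : ℝ × ℝ → ℂ), IsSmoothSymbol h₁ h₂ φ ∧ X = weylOp h₁ h₂ φ}

/-! ### The derivation operator -/

/-- `𝔥_ℂ ⊗ ℂ²`, written as column vectors `(k₁, k₂)`. -/
abbrev CplxSq : Type u := WithLp 2 (Cplx 𝔥 × Cplx 𝔥)

/-- The algebraic tensor product `B(H) ⊗ 𝔥_ℂ ⊗ ℂ²`. -/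
abbrev AlgModule : Type u := Op 𝔥 ⊗[ℂ] CplxSq 𝔥

/-- The Hilbert space `H ⊗ 𝔥_ℂ ⊗ ℂ²`. -/
abbrev FockTensor : Type u := UniformSpace.Completion (FockSpace 𝔥 ⊗[ℂ] CplxSq 𝔥)

/-- The Hilbert module `𝔐 = B(H, H ⊗ 𝔥_ℂ ⊗ ℂ²)`. -/
abbrev HilbertModule : Type u := FockSpace 𝔥 →L[ℂ] FockTensor 𝔥

variable {𝔥}

/-- `v ↦ v ⊗ k` as a bounded operator `H → H ⊗ 𝔥_ℂ ⊗ ℂ²`. -/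
def tensorRight (k : CplxSq 𝔥) : HilbertModule 𝔥 :=
  UniformSpace.Completion.toComplL ∘L
    ((TensorProduct.mkL ℂ (FockSpace 𝔥) (CplxSq 𝔥)).flip k)

variable (𝔥)

/-- The embedding of `B(H) ⊗ 𝔥_ℂ ⊗ ℂ²` into the Hilbert module `𝔐`, sending `O ⊗ k` to the operator
`v ↦ O v ⊗ k`. -/
def toHilbertModule : AlgModule 𝔥 →ₗ[ℂ] HilbertModule 𝔥 :=
  TensorProduct.lift <| LinearMap.mk₂ ℂ (fun (O : Op 𝔥) (k : CplxSq 𝔥) => tensorRight k ∘L O)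
    (fun O O' k => by simp)
    (fun c O k => by simp)
    (fun O k k' => by simp [tensorRight])
    (fun c O k => by simp [tensorRight])

variable {𝔥}

/-- The left action of `B(H)` on `B(H) ⊗ 𝔥_ℂ ⊗ ℂ²`, `O · (O₁ ⊗ k) = O O₁ ⊗ k`. -/
def leftMul (O : Op 𝔥) : AlgModule 𝔥 →ₗ[ℂ] AlgModule 𝔥 :=
  (LinearMap.mulLeft ℂ O).rTensor (CplxSq 𝔥)

/-- The right action of `B(H)` on `B(H) ⊗ 𝔥_ℂ ⊗ ℂ²`, `(O₁ ⊗ k) · O = O₁ O ⊗ k`. -/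
def rightMul (O : Op 𝔥) : AlgModule 𝔥 →ₗ[ℂ] AlgModule 𝔥 :=
  (LinearMap.mulRight ℂ O).rTensor (CplxSq 𝔥)

/-- `D` is the derivation operator: the linear operator with domain `𝒮` and values in
`B(H) ⊗ 𝔥_ℂ ⊗ ℂ²` that is given on the generators by
`D O_h(φ) = (O_h(∂φ/∂x) ⊗ h₁, O_h(∂φ/∂y) ⊗ h₂)` and is a derivation. -/
structure IsDerivationOperator (D : Op 𝔥 →ₗ.[ℂ] AlgModule 𝔥) : Prop where
  domain_eq : D.domain = Subalgebra.toSubmodule (smoothAlgebra 𝔥)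
  apply_weylOp : ∀ (h₁ h₂ : 𝔥) (φ : ℝ × ℝ → ℂ), IsSmoothSymbol h₁ h₂ φ →
    ∀ X : D.domain, (X : Op 𝔥) = weylOp h₁ h₂ φ →
      D X = weylOp h₁ h₂ (dx φ) ⊗ₜ[ℂ] WithLp.toLp 2 (Cplx.ofReal h₁, 0)
          + weylOp h₁ h₂ (dy φ) ⊗ₜ[ℂ] WithLp.toLp 2 (0, Cplx.ofReal h₂)
  leibniz : ∀ X Y Z : D.domain, (Z : Op 𝔥) = (X : Op 𝔥) * (Y : Op 𝔥) →
    D Z = leftMul (X : Op 𝔥) (D Y) + rightMul (Y : Op 𝔥) (D X)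

/-- An operator `D` from `B(H)` to `B(H) ⊗ 𝔥_ℂ ⊗ ℂ²`, regarded as an operator from `B(H)` to the
Hilbert module `𝔐`, both with the weak operator topology. -/
def toWeak (D : Op 𝔥 →ₗ.[ℂ] AlgModule 𝔥) :
    (FockSpace 𝔥 →WOT[ℂ] FockSpace 𝔥) →ₗ.[ℂ] (FockSpace 𝔥 →WOT[ℂ] FockTensor 𝔥) where
  domain := D.domain.comap (ContinuousLinearMapWOT.linearEquiv ℂ).toLinearMap
  toFun :=
    (ContinuousLinearMapWOT.linearEquiv ℂ).symm.toLinearMap ∘ₗ toHilbertModule 𝔥 ∘ₗ D.toFun ∘ₗ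
      (ContinuousLinearMapWOT.linearEquiv ℂ).toLinearMap.restrict (fun _ hX => hX)

end Weyl

end QMalliavin

end

noncomputable section

namespace QMalliavin

universe u

/-! ### Exponential vectors -/

section Exponential

open Filter Topology

variable {E : Type u} [NormedAddCommGroup E] [InnerProductSpace ℂ E]

/-! The derivation is recognised as a family of infinitesimal conjugations by Weyl operators. For
real `w₁`, `w₂` put `w = (w₂ - i w₁) / 2` (`shiftVec`). Conjugating `O_h(φ)` by `W(t w)` translates
the symbol by `t (⟪w₁, h₁⟫, ⟪w₂, h₂⟫)`, so its weak derivative at `t = 0` is `⟪w₁, h₁⟫ O_h(∂φ/∂x) +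
⟪w₂, h₂⟫ O_h(∂φ/∂y)`, which is the contraction of the prescribed `D O_h(φ)` with `(w₁, w₂)`
(`isGradient_weylOp`).

Existence and uniqueness: call `T` a gradient of `X` if all its contractions are such weak
derivatives (`IsGradient`). A tensor is determined by its contractions, so `X` determines `T`,
however `X` is written in terms of generators. Gradients obey the sum and Leibniz rules, hence exist
on all of `𝒮`, and every derivation operator must return them.

Closability: the orbits `t ↦ W(t w) ℰ(k)` are differentiable at 0. Moving the derivative from `X` to
the vectors expresses `⟪ℰ(k₁) ⊗ (w₁, w₂), (D X) ℰ(k₂)⟫` through two matrix elements of `X` at fixed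
vectors. This relation survives weak operator limits, and the vectors `ℰ(k₁) ⊗ (w₁, w₂)` are total.

The analytic core is the translation of symbols. The complex measure attached to `k₁`, `k₂` is a
multiple of a Gaussian with complex mean (`isInverseFourier_weylDensity`); shifting `k₁` and `k₂` by
`t w` moves the mean by a real vector, and integration by parts turns the derivative in the mean
into derivatives of `φ` (`hasDerivAt_integral_shiftDensity`). The integrability this needs is
contained in membership in the domain, since that concerns all `k₁`, `k₂`. -/

theorem inner_algPow (k l : E) (n : ℕ) : inner ℂ (algPow k n) (algPow l n) = inner ℂ k l ^ n := by
  induction n with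
  | zero =>
    have h : inner ℂ (EuclideanSpace.single PUnit.unit (1 : ℂ) : EuclideanSpace ℂ PUnit.{u + 1})
        (EuclideanSpace.single PUnit.unit (1 : ℂ)) = 1 := by simp
    rw [pow_zero]
    exact h
  | succ n ih =>
    have h : inner ℂ (k ⊗ₜ[ℂ] algPow k n : E ⊗[ℂ] AlgTensorPower E n) (l ⊗ₜ[ℂ] algPow l n) =
        inner ℂ k l * inner ℂ (algPow k n) (algPow l n) := TensorProduct.inner_tmul ..
    rw [pow_succ', ← ih]
    exact h

theorem algPow_smul (c : ℂ) (k : E) (n : ℕ) : algPow (c • k) n = c ^ n • algPow k n := by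
  induction n with
  | zero => rw [pow_zero, one_smul]; rfl
  | succ n ih =>
    have h : ((c • k) ⊗ₜ[ℂ] algPow (c • k) n : E ⊗[ℂ] AlgTensorPower E n) =
        c ^ (n + 1) • (k ⊗ₜ[ℂ] algPow k n) := by
      rw [ih, TensorProduct.smul_tmul_smul, pow_succ']
    exact h

theorem inner_symPow (k l : E) (n : ℕ) : inner ℂ (symPow k n) (symPow l n) = inner ℂ k l ^ n := by
  rw [← inner_algPow]
  exact UniformSpace.Completion.inner_coe _ _

theorem symPow_smul (c : ℂ) (k : E) (n : ℕ) : symPow (c • k) n = c ^ n • symPow k n := by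
  apply Subtype.ext
  simp only [symPow, algPow_smul, Submodule.coe_smul, UniformSpace.Completion.coe_smul]

theorem inner_expVec (k l : E) : inner ℂ (expVec k) (expVec l) = Complex.exp (inner ℂ k l) := by
  rw [lp.inner_eq_tsum, Complex.exp_eq_exp_ℂ, NormedSpace.exp_eq_tsum_div]
  refine tsum_congr fun n => ?_
  have h0 : (0 : ℝ) ≤ (n.factorial : ℝ) := by positivity
  have h1 : ((Real.sqrt (n.factorial : ℝ) : ℂ)) * (Real.sqrt (n.factorial : ℝ) : ℂ) =
      (n.factorial : ℂ) := by
    rw [← Complex.ofReal_mul, Real.mul_self_sqrt h0, Complex.ofReal_natCast]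
  have h2 : inner ℂ (((Real.sqrt (n.factorial : ℝ) : ℂ))⁻¹ • symPow k n)
      (((Real.sqrt (n.factorial : ℝ) : ℂ))⁻¹ • symPow l n) = inner ℂ k l ^ n / n.factorial := by
    refine (inner_smul_left (𝕜 := ℂ) (symPow k n) _ _).trans ?_
    refine (congrArg _ (inner_smul_right (𝕜 := ℂ) (symPow k n) (symPow l n) _)).trans ?_
    rw [inner_symPow, map_inv₀, Complex.conj_ofReal, ← mul_assoc, ← mul_inv, h1, div_eq_inv_mul]
  exact h2

/-- A vector orthogonal to all exponential vectors vanishes. -/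
theorem eq_zero_of_inner_expVec (ψ : Fock E) (h : ∀ k : E, inner ℂ ψ (expVec k) = 0) : ψ = 0 := by
  have key : ∀ (k : E) (n : ℕ), inner ℂ (ψ n) (symPow k n) = 0 := by
    intro k
    set a : ℕ → ℂ := fun n => ((Real.sqrt (n.factorial : ℝ) : ℂ))⁻¹ * inner ℂ (ψ n) (symPow k n)
    -- Orthogonality to `ℰ(z k)` for every complex `z` is the vanishing of a power series in `z`, so
    -- each coefficient vanishes and the degrees separate.
    have hs : ∀ z : ℂ, HasSum (fun n => z ^ n • a n) 0 := by
      intro z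
      have := lp.hasSum_inner (𝕜 := ℂ) ψ (expVec (z • k))
      rw [h] at this
      refine this.congr_fun ?_
      intro n
      have h2 : inner ℂ (ψ n : symPower E n) (((Real.sqrt (n.factorial : ℝ) : ℂ))⁻¹ •
          symPow (z • k) n) = z ^ n • a n := by
        rw [symPow_smul, smul_smul]
        refine (inner_smul_right (𝕜 := ℂ) (ψ n) (symPow k n) _).trans ?_
        simp only [a, smul_eq_mul]
        ring
      exact h2.symm
    have hp : HasFPowerSeriesAt (fun _ : ℂ => (0 : ℂ)) (FormalMultilinearSeries.ofScalars ℂ a) 0 := by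
      rw [hasFPowerSeriesAt_iff]
      refine Filter.Eventually.of_forall fun z => ?_
      have := hs z
      simpa [FormalMultilinearSeries.coeff_ofScalars] using this
    have hz := hp.eq_zero
    intro n
    have h2 : a n = 0 := by
      have := congrArg (fun p => FormalMultilinearSeries.coeff p n) hz
      simp only [FormalMultilinearSeries.coeff_ofScalars] at this
      exact this
    have h3 : ((Real.sqrt (n.factorial : ℝ) : ℂ))⁻¹ ≠ 0 := by
      simp [Nat.factorial_ne_zero]
    exact (mul_eq_zero.1 h2).resolve_left h3
  apply lp.ext
  funext n
  have hmem : ∀ x ∈ symPower E n, inner ℂ ((ψ n : symPower E n) : HilbertTensorPower E n) x = 0 := by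
    intro x hx
    have hcl : IsClosed {x : HilbertTensorPower E n |
        inner ℂ ((ψ n : symPower E n) : HilbertTensorPower E n) x = 0} :=
      isClosed_eq (by fun_prop) continuous_const
    refine closure_minimal ?_ hcl hx
    intro y hy
    induction hy using Submodule.span_induction with
    | mem y hy =>
      obtain ⟨k, rfl⟩ := hy
      exact key k n
    | zero => simp
    | add y z _ _ hy hz =>
      simp only [Set.mem_ofPred_eq] at hy hz ⊢
      rw [inner_add_right, hy, hz, add_zero]
    | smul c y _ hy =>
      simp only [Set.mem_ofPred_eq] at hy ⊢
      rw [inner_smul_right, hy, mul_zero]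
  have := hmem _ (ψ n).2
  rw [inner_self_eq_zero] at this
  exact Subtype.ext this

theorem span_expVec_dense :
    Dense (Submodule.span ℂ (Set.range (expVec : E → Fock E)) : Set (Fock E)) := by
  rw [Submodule.dense_iff_topologicalClosure_eq_top, Submodule.topologicalClosure_eq_top_iff,
    Submodule.eq_bot_iff]
  intro ψ hψ
  refine eq_zero_of_inner_expVec ψ fun k => ?_
  rw [Submodule.mem_orthogonal'] at hψ
  exact hψ _ (Submodule.subset_span ⟨k, rfl⟩)

/-- Expanding `‖q i - q j‖²` gives four inner products with the common limit `c`, so `q` is Cauchy.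
This yields limits of difference quotients of exponential vectors without naming them. -/
theorem exists_tendsto_of_tendsto_inner {ι H : Type*} [NormedAddCommGroup H] [InnerProductSpace ℂ H]
    [CompleteSpace H] {l : Filter ι} [l.NeBot] {q : ι → H} {c : ℂ}
    (h : Tendsto (fun p : ι × ι => inner ℂ (q p.1) (q p.2)) (l ×ˢ l) (𝓝 c)) :
    ∃ v, Tendsto q l (𝓝 v) := by
  have hdiag : Tendsto (fun i => inner ℂ (q i) (q i)) l (𝓝 c) :=
    h.comp (tendsto_id.prodMk tendsto_id)
  have h1 : Tendsto (fun p : ι × ι => inner ℂ (q p.1) (q p.1)) (l ×ˢ l) (𝓝 c) :=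
    hdiag.comp tendsto_fst
  have h2 : Tendsto (fun p : ι × ι => inner ℂ (q p.2) (q p.2)) (l ×ˢ l) (𝓝 c) :=
    hdiag.comp tendsto_snd
  have h3 : Tendsto (fun p : ι × ι => inner ℂ (q p.2) (q p.1)) (l ×ˢ l) (𝓝 c) :=
    h.comp (tendsto_snd.prodMk tendsto_fst)
  have h4 : Tendsto (fun p : ι × ι => inner ℂ (q p.1 - q p.2) (q p.1 - q p.2)) (l ×ˢ l) (𝓝 0) := by
    have := ((h1.sub h).sub h3).add h2
    have e : c - c - c + c = 0 := by ring
    rw [e] at this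
    refine this.congr fun p => ?_
    simp only [inner_sub_left, inner_sub_right]
    ring
  have h5 : Tendsto (fun p : ι × ι => dist (q p.1) (q p.2)) (l ×ˢ l) (𝓝 0) := by
    have := (h4.norm).sqrt
    rw [norm_zero, Real.sqrt_zero] at this
    refine this.congr fun p => ?_
    rw [inner_self_eq_norm_sq_to_K, norm_pow, dist_eq_norm]
    simp
  have hc : Cauchy (map q l) := by
    rw [cauchy_map_iff]
    exact ⟨inferInstance, tendsto_uniformity_iff_dist_tendsto_zero.2 h5⟩
  exact cauchy_map_iff_exists_tendsto.1 hc

theorem tendsto_cexp_sub_one_div {ι : Type*} {l : Filter ι} {x : ι → ℂ} (b : ℂ)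
    (hx : Tendsto x l (𝓝[≠] 0)) :
    Tendsto (fun i => (Complex.exp (b * x i) - 1) / x i) l (𝓝 b) := by
  have h : HasDerivAt (fun z : ℂ => Complex.exp (b * z)) b 0 := by
    simpa using ((hasDerivAt_id (0 : ℂ)).const_mul b).cexp
  rw [hasDerivAt_iff_tendsto_slope] at h
  refine (h.comp hx).congr fun i => ?_
  simp [slope_def_field]

/-- The exponential vectors depend differentiably on their parameter. -/
theorem exists_hasDerivAt_expVec (k w : E) :
    ∃ v, HasDerivAt (fun t : ℝ => expVec (k + (t : ℂ) • w)) v 0 := by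
  simp_rw [hasDerivAt_iff_tendsto_slope]
  -- The constant `c` is the mixed derivative `∂ₛ∂ₜ exp ⟪k + s w, k + t w⟫` at 0.
  refine exists_tendsto_of_tendsto_inner
    (c := Complex.exp (inner ℂ k k) * (inner ℂ w k * inner ℂ k w + inner ℂ w w)) ?_
  set l : Filter ℝ := 𝓝[≠] 0
  have hl : Tendsto (fun t : ℝ => (t : ℂ)) l (𝓝[≠] 0) := by
    refine tendsto_nhdsWithin_iff.2 ⟨?_, ?_⟩
    · have : Tendsto (fun t : ℝ => (t : ℂ)) (𝓝 0) (𝓝 ((0 : ℝ) : ℂ)) :=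
        Complex.continuous_ofReal.tendsto 0
      exact (by simpa using this : Tendsto (fun t : ℝ => (t : ℂ)) (𝓝 0) (𝓝 0)).mono_left
        nhdsWithin_le_nhds
    · filter_upwards [self_mem_nhdsWithin] with t ht
      simpa using ht
  have h1 : Tendsto (fun p : ℝ × ℝ => (p.1 : ℂ)) (l ×ˢ l) (𝓝[≠] 0) := hl.comp tendsto_fst
  have h2 : Tendsto (fun p : ℝ × ℝ => (p.2 : ℂ)) (l ×ˢ l) (𝓝[≠] 0) := hl.comp tendsto_snd
  have h1' := (tendsto_nhdsWithin_iff.1 h1)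
  have h2' := (tendsto_nhdsWithin_iff.1 h2)
  have h12 : Tendsto (fun p : ℝ × ℝ => (p.1 : ℂ) * p.2) (l ×ˢ l) (𝓝[≠] 0) := by
    refine tendsto_nhdsWithin_iff.2 ⟨by simpa using h1'.1.mul h2'.1, ?_⟩
    filter_upwards [h1'.2, h2'.2] with p hp hp'
    exact mul_ne_zero hp hp'
  have e1 := tendsto_cexp_sub_one_div (inner ℂ w k) h1
  have e2 := tendsto_cexp_sub_one_div (inner ℂ k w) h2
  have e3 := tendsto_cexp_sub_one_div (inner ℂ w w) h12
  have e4 : Tendsto (fun p : ℝ × ℝ => Complex.exp (inner ℂ w k * p.1 + inner ℂ k w * p.2))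
      (l ×ˢ l) (𝓝 1) := by
    have := (((h1'.1.const_mul (inner ℂ w k)).add (h2'.1.const_mul (inner ℂ k w))).cexp)
    simpa using this
  -- With `x = s ⟪w, k⟫`, `y = t ⟪k, w⟫`, `r = s t ⟪w, w⟫`, the mixed difference splits as
  -- `e^(x+y+r) - e^x - e^y + 1 = (e^x - 1)(e^y - 1) + e^(x+y) (e^r - 1)`.
  have := ((e1.mul e2).add (e4.mul e3)).const_mul (Complex.exp (inner ℂ k k))
  rw [one_mul] at this
  refine this.congr' ?_
  filter_upwards [h1'.2, h2'.2] with p hp hp'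
  have hp : (p.1 : ℂ) ≠ 0 := hp
  have hp' : (p.2 : ℂ) ≠ 0 := hp'
  simp only [slope, vsub_eq_sub, sub_zero, Complex.ofReal_zero, zero_smul, add_zero]
  have hsm : ∀ (r : ℝ) (x : Fock E), r • x = (r : ℂ) • x := fun r x => rfl
  rw [hsm, hsm, inner_smul_left, inner_smul_right, Complex.conj_ofReal]
  simp only [inner_sub_left, inner_sub_right, inner_expVec, inner_add_left, inner_add_right,
    inner_smul_left, inner_smul_right, Complex.conj_ofReal, mul_add, Complex.exp_add]
  rw [mul_comm (inner ℂ w k) (p.1 : ℂ), mul_comm (inner ℂ k w) (p.2 : ℂ),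
    show inner ℂ w w * ((p.1 : ℂ) * p.2) = p.1 * (p.2 * inner ℂ w w) by ring, Complex.ofReal_inv,
    Complex.ofReal_inv]
  field_simp
  ring

/-! ### Weyl operators -/

/-- The scalar factors cancel the terms `⟪z, z⟫`, `⟪z, g⟫` and `⟪f, z⟫` of `⟪f + z, g + z⟫`. This
isometry is what allows `weyl` to extend to the whole Fock space. -/
theorem inner_weylExp (z f g : E) :
    inner ℂ (weylExp z f) (weylExp z g) = inner ℂ (expVec f) (expVec g) := by
  simp only [weylExp, inner_smul_left, inner_smul_right, inner_expVec, ← Complex.exp_conj,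
    ← Complex.exp_add, map_sub, map_neg, map_div₀, map_pow, Complex.conj_ofReal, map_ofNat,
    inner_conj_symm, inner_add_left, inner_add_right]
  rw [inner_self_eq_norm_sq_to_K (𝕜 := ℂ) z]
  congr 1
  simp only [Complex.coe_algebraMap]
  ring

/-- The unitary Weyl operator `W(z)`. -/
def weyl (z : E) : Fock E →L[ℂ] Fock E :=
  (Finsupp.linearCombination ℂ (weylExp z)).extendOfNorm (Finsupp.linearCombination ℂ expVec)

theorem norm_linearCombination_weylExp (z : E) (x : E →₀ ℂ) :
    ‖Finsupp.linearCombination ℂ (weylExp z) x‖ = ‖Finsupp.linearCombination ℂ expVec x‖ := by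
  have h : inner ℂ (Finsupp.linearCombination ℂ (weylExp z) x)
      (Finsupp.linearCombination ℂ (weylExp z) x) =
      inner ℂ (Finsupp.linearCombination ℂ expVec x) (Finsupp.linearCombination ℂ expVec x) := by
    simp only [Finsupp.linearCombination_apply, Finsupp.sum, sum_inner, inner_sum, inner_smul_left,
      inner_smul_right, inner_weylExp]
  rw [@norm_eq_sqrt_re_inner ℂ, @norm_eq_sqrt_re_inner ℂ, h]

theorem denseRange_linearCombination_expVec :
    DenseRange (Finsupp.linearCombination ℂ (expVec : E → Fock E)) := by
  have := span_expVec_dense (E := E)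
  rw [← Finsupp.range_linearCombination] at this
  exact this

@[simp]
theorem weyl_expVec (z f : E) : weyl z (expVec f) = weylExp z f := by
  have := LinearMap.extendOfNorm_eq (f := Finsupp.linearCombination ℂ (weylExp z))
    (denseRange_linearCombination_expVec (E := E))
    ⟨1, fun x => by rw [one_mul]; exact (norm_linearCombination_weylExp z x).le⟩
    (Finsupp.single f 1)
  simp only [Finsupp.linearCombination_single, one_smul] at this
  exact this

/-- Bounded operators that agree on exponential vectors are equal. -/
theorem clm_ext_expVec {F : Type*} [NormedAddCommGroup F] [NormedSpace ℂ F] {A B : Fock E →L[ℂ] F}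
    (h : ∀ k, A (expVec k) = B (expVec k)) : A = B := by
  refine ContinuousLinearMap.ext_on (span_expVec_dense (E := E)) ?_
  rintro _ ⟨k, rfl⟩
  exact h k

/-- The phase `exp (-i Im ⟪s w, t w⟫)` of the Weyl relations is trivial, both vectors being real
multiples of `w`. -/
theorem weyl_weylExp (w k : E) (s t : ℝ) :
    weyl ((s : ℂ) • w) (weylExp ((t : ℂ) • w) k) = weylExp (((s + t : ℝ) : ℂ) • w) k := by
  rw [weylExp, map_smul, weyl_expVec, weylExp, weylExp, smul_smul, ← Complex.exp_add, add_assoc,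
    ← add_smul, ← Complex.ofReal_add, add_comm t s]
  congr 2
  simp only [inner_add_right, inner_smul_left, inner_smul_right, Complex.conj_ofReal, norm_smul,
    Complex.norm_real, Complex.ofReal_mul, mul_pow, inner_self_eq_norm_sq_to_K,
    Complex.coe_algebraMap, ← Complex.ofReal_pow, Real.norm_eq_abs, sq_abs]
  push_cast
  ring

theorem weyl_mul (w : E) (s t : ℝ) :
    weyl ((s : ℂ) • w) * weyl ((t : ℂ) • w) = weyl (((s + t : ℝ) : ℂ) • w) :=
  clm_ext_expVec fun k => by
    rw [weyl_expVec, ← weyl_weylExp, ← weyl_expVec ((t : ℂ) • w)]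
    rfl

theorem weyl_zero : weyl (0 : E) = 1 :=
  clm_ext_expVec fun k => by simp [weylExp]

theorem weyl_mul_weyl_neg (w : E) (t : ℝ) :
    weyl ((t : ℂ) • w) * weyl (((-t : ℝ) : ℂ) • w) = 1 := by
  rw [weyl_mul, add_neg_cancel, Complex.ofReal_zero, zero_smul, weyl_zero]

theorem weyl_neg_mul_weyl (w : E) (t : ℝ) :
    weyl (((-t : ℝ) : ℂ) • w) * weyl ((t : ℂ) • w) = 1 := by
  rw [weyl_mul, neg_add_cancel, Complex.ofReal_zero, zero_smul, weyl_zero]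

theorem norm_weyl_apply_le (z : E) (ψ : Fock E) : ‖weyl z ψ‖ ≤ ‖ψ‖ := by
  have := LinearMap.norm_extendOfNorm_apply_le (f := Finsupp.linearCombination ℂ (weylExp z))
    (denseRange_linearCombination_expVec (E := E)) 1
    (fun x => by rw [one_mul]; exact (norm_linearCombination_weylExp z x).le) ψ
  rwa [one_mul] at this

theorem norm_weyl_le (z : E) : ‖weyl z‖ ≤ 1 :=
  ContinuousLinearMap.opNorm_le_bound _ zero_le_one fun ψ => by
    rw [one_mul]; exact norm_weyl_apply_le z ψ

/-- Density is used one slot at a time: `h1` frees the second argument, and conjugation swaps the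
slots so that `h2` can free the other. -/
theorem inner_weyl_weyl (z : E) (ξ η : Fock E) : inner ℂ (weyl z ξ) (weyl z η) = inner ℂ ξ η := by
  have h1 : ∀ k, innerSL ℂ (weyl z (expVec k)) ∘L weyl z = innerSL ℂ (expVec k) := fun k =>
    clm_ext_expVec fun l => by simp [inner_weylExp]
  have h2 : innerSL ℂ (weyl z η) ∘L weyl z = innerSL ℂ η := by
    refine clm_ext_expVec fun k => ?_
    have h3 := congrArg (starRingEnd ℂ) (congrArg (fun A => A η) (h1 k))
    simp only [ContinuousLinearMap.comp_apply, innerSL_apply_apply, inner_conj_symm] at h3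
    simpa using h3
  have h3 := congrArg (starRingEnd ℂ) (congrArg (fun A => A ξ) h2)
  simpa only [ContinuousLinearMap.comp_apply, innerSL_apply_apply, inner_conj_symm] using h3

theorem inner_weyl_left (w : E) (t : ℝ) (ξ η : Fock E) :
    inner ℂ (weyl ((t : ℂ) • w) ξ) η = inner ℂ ξ (weyl (((-t : ℝ) : ℂ) • w) η) := by
  have h : weyl ((t : ℂ) • w) (weyl (((-t : ℝ) : ℂ) • w) η) = η :=
    congrArg (fun A : Fock E →L[ℂ] Fock E => A η) (weyl_mul_weyl_neg w t)
  rw [← inner_weyl_weyl ((t : ℂ) • w) ξ, h]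

/-- Exponential vectors lie in the domain of the generator of `t ↦ W(t w)`. Closability rests on
this. -/
theorem exists_hasDerivAt_weylExp (k w : E) :
    ∃ v, HasDerivAt (fun t : ℝ => weylExp ((t : ℂ) • w) k) v 0 := by
  obtain ⟨v, hv⟩ := exists_hasDerivAt_expVec k w
  have hs : DifferentiableAt ℝ (fun t : ℝ =>
      Complex.exp (-(‖(t : ℂ) • w‖ : ℂ) ^ 2 / 2 - inner ℂ ((t : ℂ) • w) k)) 0 := by
    have e : (fun t : ℝ => Complex.exp (-(‖(t : ℂ) • w‖ : ℂ) ^ 2 / 2 - inner ℂ ((t : ℂ) • w) k)) =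
        fun t : ℝ => Complex.exp (-((t : ℂ) ^ 2 * ‖w‖ ^ 2) / 2 - t * inner ℂ w k) := by
      funext t
      congr 2
      · rw [norm_smul, Complex.norm_real, Complex.ofReal_mul, mul_pow, ← Complex.ofReal_pow,
          Real.norm_eq_abs, sq_abs, Complex.ofReal_pow]
      · rw [inner_smul_left, Complex.conj_ofReal]
    rw [e]
    have : DifferentiableAt ℝ (fun t : ℝ => (t : ℂ)) 0 :=
      Complex.ofRealCLM.differentiableAt
    fun_prop
  exact ⟨_, hs.hasDerivAt.smul hv⟩

end Exponential

/-! ### Uniqueness of Fourier transforms -/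

section FourierUniqueness

open Filter Topology MeasureTheory

theorem integrable_withDensity_ofReal {α : Type*} [MeasurableSpace α] {μ : Measure α} {f : α → ℝ}
    (hf : Integrable f μ) {g : α → ℂ} (hgm : Measurable g)
    (hg : Integrable (fun p => g p * (f p : ℂ)) μ) :
    Integrable g (μ.withDensity fun p => ENNReal.ofReal (f p)) := by
  rw [integrable_withDensity_iff_integrable_smul₀' hf.aemeasurable.ennreal_ofReal (by simp)]
  refine hg.mono ?_ (Eventually.of_forall fun p => ?_)
  · exact (hf.aemeasurable.ennreal_ofReal.ennreal_toReal.smul hgm.aemeasurable).aestronglyMeasurable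
  · rw [norm_smul, norm_mul, mul_comm, Complex.norm_real]
    gcongr
    rw [Real.norm_of_nonneg ENNReal.toReal_nonneg, ENNReal.toReal_ofReal']
    exact max_le (Real.le_norm_self _) (norm_nonneg _)

theorem integral_withDensity_ofReal_sub {α : Type*} [MeasurableSpace α] {μ : Measure α} {f : α → ℝ}
    (hf : Integrable f μ) {g : α → ℂ} (hgm : Measurable g)
    (hg : Integrable (fun p => g p * (f p : ℂ)) μ) :
    ∫ p, g p ∂(μ.withDensity fun p => ENNReal.ofReal (f p)) -
      ∫ p, g p ∂(μ.withDensity fun p => ENNReal.ofReal (-f p)) = ∫ p, g p * (f p : ℂ) ∂μ := by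
  have hg' : Integrable (fun p => g p * ((-f p : ℝ) : ℂ)) μ := by
    refine hg.neg.congr (Eventually.of_forall fun p => ?_)
    simp
  have hfn : Integrable (fun p => -f p) μ := hf.neg
  have i1 := integrable_withDensity_ofReal hf hgm hg
  have i2 := integrable_withDensity_ofReal hfn hgm hg'
  rw [integrable_withDensity_iff_integrable_smul₀' hf.aemeasurable.ennreal_ofReal (by simp)] at i1
  rw [integrable_withDensity_iff_integrable_smul₀' hfn.aemeasurable.ennreal_ofReal
    (by simp)] at i2
  rw [integral_withDensity_eq_integral_toReal_smul₀ hf.aemeasurable.ennreal_ofReal (by simp),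
    integral_withDensity_eq_integral_toReal_smul₀ hfn.aemeasurable.ennreal_ofReal (by simp),
    ← integral_sub i1 i2]
  refine integral_congr_ae (Eventually.of_forall fun p => ?_)
  simp only [← sub_smul, ENNReal.toReal_ofReal']
  rw [max_zero_sub_max_neg_zero_eq_self, Complex.real_smul, mul_comm]

theorem integrable_char_mul {μ : Measure (ℝ × ℝ)} {f : ℝ × ℝ → ℂ} (hf : Integrable f μ) (u v : ℝ) :
    Integrable (fun p => Complex.exp (Complex.I * ((u * p.1 + v * p.2 : ℝ) : ℂ)) * f p) μ := by
  refine hf.bdd_mul (c := 1) ?_ (Eventually.of_forall fun p => ?_)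
  · exact (by fun_prop : Continuous fun p : ℝ × ℝ =>
      Complex.exp (Complex.I * ((u * p.1 + v * p.2 : ℝ) : ℂ))).aestronglyMeasurable
  · rw [mul_comm, Complex.norm_exp_ofReal_mul_I]

/-- Moving negative parts across the equation replaces the signed measures by the finite positive
measures `f⁺ μ + f'⁻ μ'` and `f'⁺ μ' + f⁻ μ`. These have the same characteristic function, hence
coincide. -/
theorem integral_eq_of_fourier_eq_real {μ μ' : Measure (ℝ × ℝ)} {f f' : ℝ × ℝ → ℝ}
    (hf : Integrable f μ) (hf' : Integrable f' μ')
    (h : ∀ u v : ℝ, ∫ p, Complex.exp (Complex.I * ((u * p.1 + v * p.2 : ℝ) : ℂ)) * (f p : ℂ) ∂μ =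
      ∫ p, Complex.exp (Complex.I * ((u * p.1 + v * p.2 : ℝ) : ℂ)) * (f' p : ℂ) ∂μ')
    {g : ℝ × ℝ → ℂ} (hgm : Measurable g) (hg : Integrable (fun p => g p * (f p : ℂ)) μ)
    (hg' : Integrable (fun p => g p * (f' p : ℂ)) μ') :
    ∫ p, g p * (f p : ℂ) ∂μ = ∫ p, g p * (f' p : ℂ) ∂μ' := by
  set a := μ.withDensity fun p => ENNReal.ofReal (f p)
  set b := μ.withDensity fun p => ENNReal.ofReal (-f p)
  set a' := μ'.withDensity fun p => ENNReal.ofReal (f' p)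
  set b' := μ'.withDensity fun p => ENNReal.ofReal (-f' p)
  have : IsFiniteMeasure a := isFiniteMeasure_withDensity_ofReal hf.2
  have : IsFiniteMeasure b := isFiniteMeasure_withDensity_ofReal hf.neg.2
  have : IsFiniteMeasure a' := isFiniteMeasure_withDensity_ofReal hf'.2
  have : IsFiniteMeasure b' := isFiniteMeasure_withDensity_ofReal hf'.neg.2
  have hfn : Integrable (fun p => -f p) μ := hf.neg
  have hfn' : Integrable (fun p => -f' p) μ' := hf'.neg
  have neg_int : ∀ {ν : Measure (ℝ × ℝ)} {f : ℝ × ℝ → ℝ} {g : ℝ × ℝ → ℂ},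
      Integrable (fun p => g p * (f p : ℂ)) ν → Integrable (fun p => g p * ((-f p : ℝ) : ℂ)) ν := by
    intro ν f g hg
    refine hg.neg.congr (Eventually.of_forall fun p => ?_)
    simp
  have key : ∀ {g : ℝ × ℝ → ℂ}, Measurable g → Integrable (fun p => g p * (f p : ℂ)) μ →
      Integrable (fun p => g p * (f' p : ℂ)) μ' →
      (∫ p, g p ∂(a + b') - ∫ p, g p ∂(a' + b) =
        ∫ p, g p * (f p : ℂ) ∂μ - ∫ p, g p * (f' p : ℂ) ∂μ') := by
    intro g hgm hg hg'
    rw [integral_add_measure (integrable_withDensity_ofReal hf hgm hg)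
        (integrable_withDensity_ofReal hfn' hgm (neg_int hg')),
      integral_add_measure (integrable_withDensity_ofReal hf' hgm hg')
        (integrable_withDensity_ofReal hfn hgm (neg_int hg)),
      ← integral_withDensity_ofReal_sub hf hgm hg, ← integral_withDensity_ofReal_sub hf' hgm hg']
    ring
  have heq : a + b' = a' + b := by
    refine Measure.ext_of_charFunDual ?_
    funext L
    rw [charFunDual_apply, charFunDual_apply]
    have hL : ∀ p : ℝ × ℝ, Complex.exp (L p * Complex.I) =
        Complex.exp (Complex.I * ((L (1, 0) * p.1 + L (0, 1) * p.2 : ℝ) : ℂ)) := by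
      intro p
      have hp : p = p.1 • ((1, 0) : ℝ × ℝ) + p.2 • ((0, 1) : ℝ × ℝ) := by ext <;> simp
      conv_lhs => rw [hp]
      rw [map_add, map_smul, map_smul, smul_eq_mul, smul_eq_mul, mul_comm, mul_comm p.1,
        mul_comm p.2]
    simp_rw [hL]
    have := key (g := fun p => Complex.exp (Complex.I * ((L (1, 0) * p.1 + L (0, 1) * p.2 : ℝ) : ℂ)))
      (by fun_prop) (integrable_char_mul hf.ofReal _ _) (integrable_char_mul hf'.ofReal _ _)
    rw [h, sub_self] at this
    exact sub_eq_zero.1 this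
  have := key hgm hg hg'
  rw [heq, sub_self] at this
  exact (sub_eq_zero.1 this.symm)

/-- Conjugating the transform at `(-u, -v)` gives the transform of the conjugate density, so the
transform of `f` determines those of `re f` and `im f`. This reduces complex densities to real ones.
-/
theorem re_im_fourier {μ : Measure (ℝ × ℝ)} {f : ℝ × ℝ → ℂ} (hf : Integrable f μ) (u v : ℝ) :
    2 * ∫ p, Complex.exp (Complex.I * ((u * p.1 + v * p.2 : ℝ) : ℂ)) * ((f p).re : ℂ) ∂μ =
        ∫ p, Complex.exp (Complex.I * ((u * p.1 + v * p.2 : ℝ) : ℂ)) * f p ∂μ +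
          starRingEnd ℂ
            (∫ p, Complex.exp (Complex.I * (((-u) * p.1 + (-v) * p.2 : ℝ) : ℂ)) * f p ∂μ) ∧
      2 * Complex.I * ∫ p, Complex.exp (Complex.I * ((u * p.1 + v * p.2 : ℝ) : ℂ)) *
          ((f p).im : ℂ) ∂μ =
        ∫ p, Complex.exp (Complex.I * ((u * p.1 + v * p.2 : ℝ) : ℂ)) * f p ∂μ -
          starRingEnd ℂ
            (∫ p, Complex.exp (Complex.I * (((-u) * p.1 + (-v) * p.2 : ℝ) : ℂ)) * f p ∂μ) := by
  have hc : starRingEnd ℂ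
      (∫ p, Complex.exp (Complex.I * (((-u) * p.1 + (-v) * p.2 : ℝ) : ℂ)) * f p ∂μ) =
      ∫ p, Complex.exp (Complex.I * ((u * p.1 + v * p.2 : ℝ) : ℂ)) * starRingEnd ℂ (f p) ∂μ := by
    rw [← integral_conj]
    refine integral_congr_ae (Eventually.of_forall fun p => ?_)
    simp only [map_mul, ← Complex.exp_conj, Complex.conj_I, Complex.conj_ofReal]
    congr 2
    push_cast
    ring
  have hfc : Integrable (fun p => starRingEnd ℂ (f p)) μ :=
    Complex.conjCLE.toContinuousLinearMap.integrable_comp hf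
  have i1 := integrable_char_mul hf u v
  have i2 := integrable_char_mul hfc u v
  rw [hc, ← integral_add i1 i2, ← integral_sub i1 i2, ← integral_const_mul, ← integral_const_mul]
  refine ⟨integral_congr_ae (Eventually.of_forall fun p => ?_),
    integral_congr_ae (Eventually.of_forall fun p => ?_)⟩
  · simp only [← mul_add, Complex.add_conj]
    push_cast
    ring
  · simp only [← mul_sub, Complex.sub_conj]
    push_cast
    ring

/-- Two complex measures `f μ` and `f' μ'` on `ℝ²` with the same Fourier transform assign the same
integrals to all functions that are integrable with respect to both. -/
theorem integral_eq_of_fourier_eq {μ μ' : Measure (ℝ × ℝ)} {f f' : ℝ × ℝ → ℂ}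
    (hf : Integrable f μ) (hf' : Integrable f' μ')
    (h : ∀ u v : ℝ, ∫ p, Complex.exp (Complex.I * ((u * p.1 + v * p.2 : ℝ) : ℂ)) * f p ∂μ =
      ∫ p, Complex.exp (Complex.I * ((u * p.1 + v * p.2 : ℝ) : ℂ)) * f' p ∂μ')
    {g : ℝ × ℝ → ℂ} (hgm : Measurable g) (hg : Integrable (fun p => g p * f p) μ)
    (hg' : Integrable (fun p => g p * f' p) μ') :
    ∫ p, g p * f p ∂μ = ∫ p, g p * f' p ∂μ' := by
  have split : ∀ {ν : Measure (ℝ × ℝ)} {f : ℝ × ℝ → ℂ}, Integrable f ν →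
      Integrable (fun p => g p * f p) ν →
      Integrable (fun p => g p * ((f p).re : ℂ)) ν ∧ Integrable (fun p => g p * ((f p).im : ℂ)) ν ∧
      ∫ p, g p * f p ∂ν = ∫ p, g p * ((f p).re : ℂ) ∂ν + (∫ p, g p * ((f p).im : ℂ) ∂ν) * Complex.I
      := by
    intro ν f hf hg
    have i1 : Integrable (fun p => g p * ((f p).re : ℂ)) ν := by
      refine hg.mono (hgm.aestronglyMeasurable.mul hf.re.ofReal.aestronglyMeasurable)
        (Eventually.of_forall fun p => ?_)
      rw [norm_mul, norm_mul, Complex.norm_real]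
      gcongr
      exact Complex.abs_re_le_norm _
    have i2 : Integrable (fun p => g p * ((f p).im : ℂ)) ν := by
      refine hg.mono (hgm.aestronglyMeasurable.mul hf.im.ofReal.aestronglyMeasurable)
        (Eventually.of_forall fun p => ?_)
      rw [norm_mul, norm_mul, Complex.norm_real]
      gcongr
      exact Complex.abs_im_le_norm _
    refine ⟨i1, i2, ?_⟩
    rw [← integral_mul_const, ← integral_add i1 (i2.mul_const _)]
    refine integral_congr_ae (Eventually.of_forall fun p => ?_)
    simp only [mul_assoc, ← mul_add, Complex.re_add_im]
  obtain ⟨r1, m1, e1⟩ := split hf hg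
  obtain ⟨r2, m2, e2⟩ := split hf' hg'
  rw [e1, e2]
  congr 1
  · refine integral_eq_of_fourier_eq_real hf.re hf'.re ?_ hgm r1 r2
    intro u v
    have h1 := (re_im_fourier hf u v).1
    rw [h, h, ← (re_im_fourier hf' u v).1] at h1
    exact mul_left_cancel₀ (by simp) h1
  · congr 1
    refine integral_eq_of_fourier_eq_real hf.im hf'.im ?_ hgm m1 m2
    intro u v
    have h1 := (re_im_fourier hf u v).2
    rw [h, h, ← (re_im_fourier hf' u v).2] at h1
    exact mul_left_cancel₀ (by simp) h1

/-- Integrability depends only on the Fourier transform of the complex measure. -/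
theorem integrable_of_fourier_eq {μ μ' : Measure (ℝ × ℝ)} {f f' : ℝ × ℝ → ℂ}
    (hf : Integrable f μ) (hf' : Integrable f' μ') (hfm : Measurable f')
    (h : ∀ u v : ℝ, ∫ p, Complex.exp (Complex.I * ((u * p.1 + v * p.2 : ℝ) : ℂ)) * f p ∂μ =
      ∫ p, Complex.exp (Complex.I * ((u * p.1 + v * p.2 : ℝ) : ℂ)) * f' p ∂μ')
    {g : ℝ × ℝ → ℂ} (hgm : Measurable g) (hg : Integrable (fun p => g p * f p) μ) :
    Integrable (fun p => g p * f' p) μ' := by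
  -- On the sets where `‖g‖ ≤ n` the product `g f'` is integrable; it remains to bound its `L¹` norm
  -- there uniformly in `n`.
  set S : ℕ → Set (ℝ × ℝ) := fun n => {p | ‖g p‖ ≤ n}
  have hS : ∀ n, MeasurableSet (S n) := fun n => measurableSet_le hgm.norm measurable_const
  have hcov : AECover μ' atTop S :=
    { ae_eventually_mem := Eventually.of_forall fun p => by
        obtain ⟨N, hN⟩ := exists_nat_ge ‖g p‖
        filter_upwards [eventually_ge_atTop N] with n hn
        exact hN.trans (by exact_mod_cast hn)
      measurableSet := hS }
  have hbd : ∀ n, IntegrableOn (fun p => g p * f' p) (S n) μ' := by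
    intro n
    refine (hf'.integrableOn (s := S n)).bdd_mul (c := n) hgm.aestronglyMeasurable ?_
    exact (ae_restrict_iff' (hS n)).2 (Eventually.of_forall fun p hp => hp)
  refine hcov.integrable_of_integral_norm_bounded (∫ p, ‖g p * f p‖ ∂μ) hbd
    (Eventually.of_forall fun n => ?_)
  -- `G` carries the conjugate phase of `f'`, so `G f' = ‖g f'‖` on `S n` while `‖G‖ ≤ ‖g‖`. Where
  -- `f' = 0` the quotient is 0 by convention.
  set G : ℝ × ℝ → ℂ := (S n).indicator fun p =>
    (‖g p‖ : ℂ) * (starRingEnd ℂ (f' p) / (‖f' p‖ : ℂ)) with hG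
  have hGm : Measurable G := by
    refine Measurable.indicator ?_ (hS n)
    exact (Complex.measurable_ofReal.comp hgm.norm).mul
      ((Complex.continuous_conj.measurable.comp hfm).div
        (Complex.measurable_ofReal.comp hfm.norm))
  have hGle : ∀ p, ‖G p‖ ≤ ‖g p‖ := by
    intro p
    by_cases hp : p ∈ S n
    · simp only [hG, Set.indicator_of_mem hp, norm_mul, norm_div, Complex.norm_real, norm_norm,
        RCLike.norm_conj]
      exact mul_le_of_le_one_right (norm_nonneg _) (div_self_le_one _)
    · simp only [hG, Set.indicator_of_notMem hp, norm_zero, norm_nonneg]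
  have hGmul : ∀ p, G p * f' p = (((S n).indicator (fun p => ‖g p * f' p‖) p : ℝ) : ℂ) := by
    intro p
    by_cases hp : p ∈ S n
    · simp only [hG, Set.indicator_of_mem hp, norm_mul, Complex.ofReal_mul]
      by_cases hz : f' p = 0
      · simp [hz]
      · have hz' : (‖f' p‖ : ℂ) ≠ 0 := by simpa using hz
        rw [mul_assoc, div_mul_eq_mul_div, Complex.conj_mul', sq, mul_div_assoc,
          div_self hz', mul_one]
    · simp only [hG, Set.indicator_of_notMem hp, zero_mul, Complex.ofReal_zero]
  have i1 : Integrable (fun p => G p * f p) μ := by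
    refine hg.mono (hGm.aestronglyMeasurable.mul hf.aestronglyMeasurable)
      (Eventually.of_forall fun p => ?_)
    rw [norm_mul, norm_mul]
    gcongr
    exact hGle p
  have i2 : Integrable (fun p => G p * f' p) μ' := by
    simp_rw [hGmul]
    exact ((integrable_indicator_iff (hS n)).2 (Integrable.norm (hbd n))).ofReal
  have heq := integral_eq_of_fourier_eq hf hf' h hGm i1 i2
  have h3 : ((∫ p in S n, ‖g p * f' p‖ ∂μ' : ℝ) : ℂ) = ∫ p, G p * f p ∂μ := by
    rw [heq]
    simp_rw [hGmul]
    rw [integral_complex_ofReal, integral_indicator (hS n)]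
  calc ∫ p in S n, ‖g p * f' p‖ ∂μ' ≤ ‖((∫ p in S n, ‖g p * f' p‖ ∂μ' : ℝ) : ℂ)‖ := by
        rw [Complex.norm_real]; exact Real.le_norm_self _
    _ = ‖∫ p, G p * f p ∂μ‖ := by rw [h3]
    _ ≤ ∫ p, ‖G p * f p‖ ∂μ := norm_integral_le_integral_norm _
    _ ≤ ∫ p, ‖g p * f p‖ ∂μ := by
        refine integral_mono i1.norm hg.norm fun p => ?_
        simp only [norm_mul]
        gcongr
        exact hGle p

end FourierUniqueness

/-! ### Tilted Gaussian integrals -/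

section Gaussian

open Filter Topology MeasureTheory ProbabilityTheory
open scoped NNReal

/-- Differentiation of `∫ f exp (t S)` in `t`. -/
theorem hasDerivAt_integral_mul_exp {Ω : Type*} [MeasurableSpace Ω] {μ : Measure Ω} {f : Ω → ℂ}
    {S : Ω → ℝ} (hS : Measurable S)
    (hf : ∀ t : ℝ, Integrable (fun p => f p * (Real.exp (t * S p) : ℂ)) μ) (t : ℝ) :
    Integrable (fun p => f p * (S p * Real.exp (t * S p) : ℂ)) μ ∧
      HasDerivAt (fun t : ℝ => ∫ p, f p * (Real.exp (t * S p) : ℂ) ∂μ)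
        (∫ p, f p * (S p * Real.exp (t * S p) : ℂ) ∂μ) t := by
  have hfm : AEStronglyMeasurable f μ := by
    have := (hf 0).aestronglyMeasurable
    simpa using this
  -- For `|x - t| < 1`, `|S| e^(xS) ≤ e^|S| e^(tS + |S|) = e^(tS + 2|S|)`, which is at most
  -- `e^((t+2)S) + e^((t-2)S)`; hence the two shifts by 2 in the bound.
  refine hasDerivAt_integral_of_dominated_loc_of_deriv_le (s := Metric.ball t 1)
    (F := fun (t : ℝ) p => f p * (Real.exp (t * S p) : ℂ))
    (F' := fun (t : ℝ) p => f p * (S p * Real.exp (t * S p) : ℂ))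
    (bound := fun p => ‖f p * (Real.exp ((t + 2) * S p) : ℂ)‖ +
      ‖f p * (Real.exp ((t - 2) * S p) : ℂ)‖)
    (Metric.ball_mem_nhds t one_pos) (Eventually.of_forall fun t => (hf t).aestronglyMeasurable)
    (hf t) ?_ ?_ ((hf _).norm.add (hf _).norm) ?_
  · refine hfm.mul (Measurable.aestronglyMeasurable ?_)
    fun_prop
  · refine Eventually.of_forall fun p x hx => ?_
    rw [Metric.mem_ball, Real.dist_eq] at hx
    simp only [norm_mul, Complex.norm_real, Real.norm_eq_abs, Real.abs_exp]
    rw [← mul_add]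
    refine mul_le_mul_of_nonneg_left ?_ (norm_nonneg _)
    have h1 : |S p| ≤ Real.exp |S p| := by linarith [Real.add_one_le_exp |S p|]
    have h2 : x * S p ≤ t * S p + |S p| := by
      have h3 : (x - t) * S p ≤ |x - t| * |S p| := by rw [← abs_mul]; exact le_abs_self _
      have h4 : |x - t| * |S p| ≤ 1 * |S p| := by gcongr
      linarith
    calc |S p| * Real.exp (x * S p) ≤ Real.exp |S p| * Real.exp (t * S p + |S p|) := by gcongr
      _ = Real.exp (t * S p + 2 * |S p|) := by rw [← Real.exp_add]; congr 1; ring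
      _ ≤ Real.exp ((t + 2) * S p) + Real.exp ((t - 2) * S p) := by
        rcases abs_cases (S p) with ⟨h, _⟩ | ⟨h, _⟩
        · rw [h, show t * S p + 2 * S p = (t + 2) * S p by ring]
          linarith [Real.exp_pos ((t - 2) * S p)]
        · rw [h, show t * S p + 2 * -S p = (t - 2) * S p by ring]
          linarith [Real.exp_pos ((t + 2) * S p)]
  · refine Eventually.of_forall fun p x _ => ?_
    have h1 : HasDerivAt (fun x : ℝ => Real.exp (x * S p)) (S p * Real.exp (x * S p)) x := by
      simpa [mul_comm] using ((hasDerivAt_id x).mul_const (S p)).exp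
    have h2 := h1.ofReal_comp.const_mul (f p)
    simpa using h2

/-- The weight `v`, Gaussian density times `exp (a x / σ)`, satisfies `v' = (a / σ - x / σ) v`. No
decay of `f` is assumed: the boundary terms vanish because `f v`, `f' v` and `f v'` are integrable.
-/
theorem integral_gaussianReal_ibp {σ : ℝ≥0} (hσ : σ ≠ 0) {f f' : ℝ → ℂ}
    (hf : ∀ x, HasDerivAt f (f' x) x) (a : ℂ)
    (i0 : Integrable (fun x : ℝ => f x * Complex.exp (a * (x / σ : ℝ))) (gaussianReal 0 σ))
    (i1 : Integrable (fun x : ℝ => f' x * Complex.exp (a * (x / σ : ℝ))) (gaussianReal 0 σ))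
    (i2 : Integrable (fun x : ℝ => f x * ((x / σ : ℝ) * Complex.exp (a * (x / σ : ℝ))))
      (gaussianReal 0 σ)) :
    ∫ x, f' x * Complex.exp (a * (x / σ : ℝ)) ∂(gaussianReal 0 σ) =
      ∫ x, f x * (((x / σ : ℝ) - a / σ) * Complex.exp (a * (x / σ : ℝ))) ∂(gaussianReal 0 σ) := by
  have hσ' : (σ : ℝ) ≠ 0 := by exact_mod_cast hσ
  have hσc : (σ : ℂ) ≠ 0 := by exact_mod_cast hσ
  have toVol : ∀ {g : ℝ → ℂ}, Integrable g (gaussianReal 0 σ) →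
      Integrable (fun x => (gaussianPDFReal 0 σ x : ℂ) * g x) := by
    intro g hg
    rw [gaussianReal_of_var_ne_zero _ hσ, integrable_withDensity_iff_integrable_smul'
      (measurable_gaussianPDF 0 σ) (Eventually.of_forall fun x => gaussianPDF_lt_top)] at hg
    simpa [toReal_gaussianPDF] using hg
  have i3 : Integrable (fun x : ℝ => f x * (((x / σ : ℝ) - a / σ) *
      Complex.exp (a * (x / σ : ℝ)))) (gaussianReal 0 σ) := by
    refine (i2.sub (i0.const_mul (a / σ))).congr (Eventually.of_forall fun x => ?_)
    simp only [Pi.sub_apply]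
    ring
  set v : ℝ → ℂ := fun x => (gaussianPDFReal 0 σ x : ℂ) * Complex.exp (a * (x / σ : ℝ)) with hv
  have hpdf : ∀ x, HasDerivAt (fun x => gaussianPDFReal 0 σ x)
      (-(x / σ) * gaussianPDFReal 0 σ x) x := by
    intro x
    rw [gaussianPDFReal_def]
    have h1 : HasDerivAt (fun x : ℝ => -(x - 0) ^ 2 / (2 * (σ : ℝ))) (-(x / σ)) x := by
      have := ((((hasDerivAt_id x).sub_const 0).pow 2).neg).div_const (2 * (σ : ℝ))
      refine this.congr_deriv ?_
      simp only [id]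
      field_simp
      ring
    refine (h1.exp.const_mul _).congr_deriv ?_
    ring
  have hvd : ∀ x, HasDerivAt v ((a / σ - (x / σ : ℝ)) * v x) x := by
    intro x
    have h1 : HasDerivAt (fun x : ℝ => Complex.exp (a * (x / σ : ℝ)))
        (Complex.exp (a * (x / σ : ℝ)) * (a / σ)) x := by
      have : HasDerivAt (fun x : ℝ => a * ((x / σ : ℝ) : ℂ)) (a / σ) x := by
        have := (((hasDerivAt_id x).div_const (σ : ℝ)).ofReal_comp).const_mul a
        refine this.congr_deriv ?_
        push_cast
        ring
      exact this.cexp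
    refine ((hpdf x).ofReal_comp.mul h1).congr_deriv ?_
    simp only [hv]
    push_cast
    ring
  have hmain := integral_mul_deriv_eq_deriv_mul_of_integrable (u := f) (u' := f') (v := v)
    (v' := fun x => (a / σ - (x / σ : ℝ)) * v x) (fun x _ => hf x) (fun x _ => hvd x)
    (by
      refine (toVol i3).neg.congr (Eventually.of_forall fun x => ?_)
      simp only [hv, Pi.neg_apply, Pi.mul_apply]
      ring)
    (by
      refine (toVol i1).congr (Eventually.of_forall fun x => ?_)
      simp only [hv, Pi.mul_apply]
      ring)
    (by
      refine (toVol i0).congr (Eventually.of_forall fun x => ?_)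
      simp only [hv, Pi.mul_apply]
      ring)
  rw [integral_gaussianReal_eq_integral_smul hσ, integral_gaussianReal_eq_integral_smul hσ]
  calc ∫ x, gaussianPDFReal 0 σ x • (f' x * Complex.exp (a * (x / σ : ℝ)))
      = ∫ x, f' x * v x := by
        refine integral_congr_ae (Eventually.of_forall fun x => ?_)
        simp only [hv, Complex.real_smul]
        ring
    _ = -∫ x, f x * ((a / σ - (x / σ : ℝ)) * v x) := by rw [hmain, neg_neg]
    _ = ∫ x, gaussianPDFReal 0 σ x • (f x * (((x / σ : ℝ) - a / σ) *
          Complex.exp (a * (x / σ : ℝ)))) := by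
        rw [← integral_neg]
        refine integral_congr_ae (Eventually.of_forall fun x => ?_)
        simp only [hv, Complex.real_smul]
        ring

theorem integral_prod_gaussianReal_ibp {σ : ℝ≥0} (hσ : σ ≠ 0) {ν : Measure ℝ} [SFinite ν]
    {f f' : ℝ × ℝ → ℂ} (hf : ∀ x y, HasDerivAt (fun x => f (x, y)) (f' (x, y)) x) (a : ℂ)
    (i0 : Integrable (fun p : ℝ × ℝ => f p * Complex.exp (a * (p.1 / σ : ℝ)))
      ((gaussianReal 0 σ).prod ν))
    (i1 : Integrable (fun p : ℝ × ℝ => f' p * Complex.exp (a * (p.1 / σ : ℝ)))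
      ((gaussianReal 0 σ).prod ν))
    (i2 : Integrable (fun p : ℝ × ℝ => f p * ((p.1 / σ : ℝ) * Complex.exp (a * (p.1 / σ : ℝ))))
      ((gaussianReal 0 σ).prod ν)) :
    ∫ p, f' p * Complex.exp (a * (p.1 / σ : ℝ)) ∂((gaussianReal 0 σ).prod ν) =
      ∫ p, f p * (((p.1 / σ : ℝ) - a / σ) * Complex.exp (a * (p.1 / σ : ℝ)))
        ∂((gaussianReal 0 σ).prod ν) := by
  have i3 : Integrable (fun p : ℝ × ℝ => f p * (((p.1 / σ : ℝ) - a / σ) *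
      Complex.exp (a * (p.1 / σ : ℝ)))) ((gaussianReal 0 σ).prod ν) := by
    refine (i2.sub (i0.const_mul (a / σ))).congr (Eventually.of_forall fun p => ?_)
    simp only [Pi.sub_apply]
    ring
  rw [integral_prod_symm _ i1, integral_prod_symm _ i3]
  refine integral_congr_ae ?_
  filter_upwards [i0.prod_left_ae, i1.prod_left_ae, i2.prod_left_ae] with y h0 h1 h2
  exact integral_gaussianReal_ibp hσ (fun x => hf x y) a h0 h1 h2

/-- The product of two centred Gaussian measures. -/
def gauss₂ (σ τ : ℝ≥0) : Measure (ℝ × ℝ) := (gaussianReal 0 σ).prod (gaussianReal 0 τ)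

/-- The exponential weight `exp (a x / σ + b y / τ)`. -/
def tilt (σ τ : ℝ≥0) (a b : ℂ) (p : ℝ × ℝ) : ℂ :=
  Complex.exp (a * (p.1 / σ : ℝ) + b * (p.2 / τ : ℝ))

theorem continuous_tilt (σ τ : ℝ≥0) (a b : ℂ) : Continuous (tilt σ τ a b) := by
  unfold tilt; fun_prop

theorem norm_tilt (σ τ : ℝ≥0) (a b : ℂ) (p : ℝ × ℝ) :
    ‖tilt σ τ a b p‖ = ‖tilt σ τ a.re b.re p‖ := by
  simp [tilt, Complex.norm_exp]

theorem tilt_add (σ τ : ℝ≥0) (a b a' b' : ℂ) (p : ℝ × ℝ) :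
    tilt σ τ (a + a') (b + b') p = tilt σ τ a b p * tilt σ τ a' b' p := by
  simp only [tilt, ← Complex.exp_add]
  congr 1
  ring

theorem tilt_ofReal (σ τ : ℝ≥0) (a b t : ℝ) (p : ℝ × ℝ) :
    tilt σ τ (t * a) (t * b) p = (Real.exp (t * (a * (p.1 / σ) + b * (p.2 / τ))) : ℂ) := by
  simp only [tilt, Complex.ofReal_exp]
  congr 1
  push_cast
  ring

theorem tilt_swap (σ τ : ℝ≥0) (a b : ℂ) (p : ℝ × ℝ) : tilt σ τ a b p.swap = tilt τ σ b a p := by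
  simp only [tilt, Prod.fst_swap, Prod.snd_swap, add_comm]

/-- `φ` is integrable against all exponentially tilted Gaussian measures. -/
def TiltIntegrable (σ τ : ℝ≥0) (φ : ℝ × ℝ → ℂ) : Prop :=
  ∀ a b : ℝ, Integrable (fun p => φ p * tilt σ τ a b p) (gauss₂ σ τ)

theorem TiltIntegrable.swap {σ τ : ℝ≥0} {φ : ℝ × ℝ → ℂ} (h : TiltIntegrable σ τ φ) :
    TiltIntegrable τ σ (fun p => φ p.swap) := by
  intro a b
  have := (h b a).swap
  refine this.congr (Eventually.of_forall fun p => ?_)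
  simp only [Function.comp_apply, tilt_swap]

theorem TiltIntegrable.aestronglyMeasurable {σ τ : ℝ≥0} {φ : ℝ × ℝ → ℂ}
    (h : TiltIntegrable σ τ φ) : AEStronglyMeasurable φ (gauss₂ σ τ) := by
  have := (h 0 0).aestronglyMeasurable
  simpa [tilt] using this

theorem TiltIntegrable.complex {σ τ : ℝ≥0} {φ : ℝ × ℝ → ℂ} (h : TiltIntegrable σ τ φ) (a b : ℂ) :
    Integrable (fun p => φ p * tilt σ τ a b p) (gauss₂ σ τ) := by
  refine (h a.re b.re).mono
    (h.aestronglyMeasurable.mul (continuous_tilt σ τ a b).aestronglyMeasurable)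
    (Eventually.of_forall fun p => ?_)
  rw [norm_mul, norm_mul, norm_tilt]

theorem TiltIntegrable.hasDerivAt {σ τ : ℝ≥0} {φ : ℝ × ℝ → ℂ} (h : TiltIntegrable σ τ φ)
    (a b : ℂ) (c d : ℝ) (t : ℝ) :
    Integrable (fun p => φ p * (((c * (p.1 / σ) + d * (p.2 / τ) : ℝ) : ℂ) *
      tilt σ τ (a + t * c) (b + t * d) p)) (gauss₂ σ τ) ∧
    HasDerivAt (fun t : ℝ => ∫ p, φ p * tilt σ τ (a + t * c) (b + t * d) p ∂(gauss₂ σ τ))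
      (∫ p, φ p * (((c * (p.1 / σ) + d * (p.2 / τ) : ℝ) : ℂ) *
        tilt σ τ (a + t * c) (b + t * d) p) ∂(gauss₂ σ τ)) t := by
  have hS : Measurable fun p : ℝ × ℝ => c * (p.1 / σ) + d * (p.2 / τ) := by fun_prop
  have := hasDerivAt_integral_mul_exp (μ := gauss₂ σ τ) (f := fun p => φ p * tilt σ τ a b p) hS
    (fun t => by
      refine (h.complex (a + t * c) (b + t * d)).congr (Eventually.of_forall fun p => ?_)
      simp only [tilt_add, tilt_ofReal, mul_assoc]) t
  refine ⟨this.1.congr (Eventually.of_forall fun p => ?_), ?_⟩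
  · simp only [tilt_add, tilt_ofReal]
    ring
  · convert this.2 using 1
    · funext t
      simp only [tilt_add, tilt_ofReal, mul_assoc]
    · refine integral_congr_ae (Eventually.of_forall fun p => ?_)
      simp only [tilt_add, tilt_ofReal]
      ring

/-- Differentiating the exponential family in the direction `(1, 0)` supplies the polynomial factor
at no cost. -/
theorem TiltIntegrable.fst_mul {σ τ : ℝ≥0} {φ : ℝ × ℝ → ℂ} (h : TiltIntegrable σ τ φ) (a b : ℂ) :
    Integrable (fun p => φ p * ((p.1 / σ : ℝ) * tilt σ τ a b p)) (gauss₂ σ τ) := by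
  simpa using (h.hasDerivAt a b 1 0 0).1

theorem TiltIntegrable.snd_mul {σ τ : ℝ≥0} {φ : ℝ × ℝ → ℂ} (h : TiltIntegrable σ τ φ) (a b : ℂ) :
    Integrable (fun p => φ p * ((p.2 / τ : ℝ) * tilt σ τ a b p)) (gauss₂ σ τ) := by
  simpa using (h.hasDerivAt a b 0 1 0).1

theorem tilt_eq_mul (σ τ : ℝ≥0) (a b : ℂ) (p : ℝ × ℝ) :
    tilt σ τ a b p = Complex.exp (b * (p.2 / τ : ℝ)) * Complex.exp (a * (p.1 / σ : ℝ)) := by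
  rw [tilt, add_comm, Complex.exp_add]

theorem TiltIntegrable.ibp_fst {σ τ : ℝ≥0} (hσ : σ ≠ 0) {φ φ' : ℝ × ℝ → ℂ}
    (h : TiltIntegrable σ τ φ) (h' : TiltIntegrable σ τ φ')
    (hφ : ∀ x y, HasDerivAt (fun x => φ (x, y)) (φ' (x, y)) x) (a b : ℂ) :
    ∫ p, φ' p * tilt σ τ a b p ∂(gauss₂ σ τ) =
      ∫ p, φ p * ((p.1 / σ : ℝ) * tilt σ τ a b p) ∂(gauss₂ σ τ) -
        a / σ * ∫ p, φ p * tilt σ τ a b p ∂(gauss₂ σ τ) := by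
  have i0 := h.complex a b
  have i1 := h'.complex a b
  have i2 := h.fst_mul a b
  rw [← integral_const_mul, ← integral_sub i2 (i0.const_mul _)]
  have := integral_prod_gaussianReal_ibp hσ (ν := gaussianReal 0 τ)
    (f := fun p => φ p * Complex.exp (b * (p.2 / τ : ℝ)))
    (f' := fun p => φ' p * Complex.exp (b * (p.2 / τ : ℝ)))
    (fun x y => (hφ x y).mul_const (Complex.exp (b * (y / τ : ℝ)))) a
    (i0.congr (Eventually.of_forall fun p => by simp only [tilt_eq_mul]; ring))
    (i1.congr (Eventually.of_forall fun p => by simp only [tilt_eq_mul]; ring))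
    (i2.congr (Eventually.of_forall fun p => by simp only [tilt_eq_mul]; ring))
  refine Eq.trans ?_ (this.trans ?_)
  · refine integral_congr_ae (Eventually.of_forall fun p => ?_)
    simp only [tilt_eq_mul]; ring
  · refine integral_congr_ae (Eventually.of_forall fun p => ?_)
    simp only [tilt_eq_mul]; ring

theorem integral_gauss₂_swap (σ τ : ℝ≥0) (f : ℝ × ℝ → ℂ) :
    ∫ p, f p.swap ∂(gauss₂ τ σ) = ∫ p, f p ∂(gauss₂ σ τ) :=
  integral_prod_swap f

theorem TiltIntegrable.ibp_snd {σ τ : ℝ≥0} (hτ : τ ≠ 0) {φ φ' : ℝ × ℝ → ℂ}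
    (h : TiltIntegrable σ τ φ) (h' : TiltIntegrable σ τ φ')
    (hφ : ∀ x y, HasDerivAt (fun y => φ (x, y)) (φ' (x, y)) y) (a b : ℂ) :
    ∫ p, φ' p * tilt σ τ a b p ∂(gauss₂ σ τ) =
      ∫ p, φ p * ((p.2 / τ : ℝ) * tilt σ τ a b p) ∂(gauss₂ σ τ) -
        b / τ * ∫ p, φ p * tilt σ τ a b p ∂(gauss₂ σ τ) := by
  have := h.swap.ibp_fst hτ h'.swap (fun y x => hφ x y) b a
  simp_rw [← tilt_swap σ τ a b, ← Prod.snd_swap] at this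
  rw [integral_gauss₂_swap σ τ fun p => φ' p * tilt σ τ a b p,
    integral_gauss₂_swap σ τ fun p => φ p * tilt σ τ a b p,
    integral_gauss₂_swap σ τ fun p => φ p * ((p.2 / τ : ℝ) * tilt σ τ a b p)] at this
  exact this

/-- The density of the Gaussian measure with complex mean `(m, n)` and variances `(σ, τ)` with
respect to the centred one. -/
def shiftDensity (σ τ : ℝ≥0) (m n : ℂ) (p : ℝ × ℝ) : ℂ :=
  Complex.exp (-(m ^ 2 / (2 * σ)) - n ^ 2 / (2 * τ)) * tilt σ τ m n p

/-- The derivative of a Gaussian integral under a shift of the mean. -/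
theorem hasDerivAt_integral_shiftDensity {σ τ : ℝ≥0} {φ φx φy : ℝ × ℝ → ℂ}
    (h : TiltIntegrable σ τ φ) (hx : TiltIntegrable σ τ φx) (hy : TiltIntegrable σ τ φy)
    (hφx : ∀ x y, HasDerivAt (fun x => φ (x, y)) (φx (x, y)) x)
    (hφy : ∀ x y, HasDerivAt (fun y => φ (x, y)) (φy (x, y)) y)
    (m n : ℂ) (c d : ℝ) (hc : σ = 0 → c = 0) (hd : τ = 0 → d = 0) (t : ℝ) :
    HasDerivAt (fun t : ℝ => ∫ p, φ p * shiftDensity σ τ (m + t * c) (n + t * d) p ∂(gauss₂ σ τ))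
      (c * ∫ p, φx p * shiftDensity σ τ (m + t * c) (n + t * d) p ∂(gauss₂ σ τ) +
        d * ∫ p, φy p * shiftDensity σ τ (m + t * c) (n + t * d) p ∂(gauss₂ σ τ)) t := by
  have pull : ∀ (ψ : ℝ × ℝ → ℂ) (a b : ℂ), ∫ p, ψ p * shiftDensity σ τ a b p ∂(gauss₂ σ τ) =
      Complex.exp (-(a ^ 2 / (2 * σ)) - b ^ 2 / (2 * τ)) *
        ∫ p, ψ p * tilt σ τ a b p ∂(gauss₂ σ τ) := by
    intro ψ a b
    rw [← integral_const_mul]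
    refine integral_congr_ae (Eventually.of_forall fun p => ?_)
    simp only [shiftDensity]
    ring
  simp_rw [pull]
  have hlin : ∀ (a : ℂ) (c : ℝ), HasDerivAt (fun t : ℝ => a + t * c) (c : ℂ) t := by
    intro a c
    have := ((hasDerivAt_id t).ofReal_comp.mul_const (c : ℂ)).const_add a
    simpa using this
  have hq : HasDerivAt (fun t : ℝ => Complex.exp (-((m + t * c) ^ 2 / (2 * σ)) -
      (n + t * d) ^ 2 / (2 * τ)))
      (Complex.exp (-((m + t * c) ^ 2 / (2 * σ)) - (n + t * d) ^ 2 / (2 * τ)) *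
        (-(c * ((m + t * c) / σ)) - d * ((n + t * d) / τ))) t := by
    have := ((((hlin m c).pow 2).div_const (2 * (σ : ℂ))).neg.sub
      (((hlin n d).pow 2).div_const (2 * (τ : ℂ)))).cexp
    refine this.congr_deriv ?_
    simp only [Nat.cast_ofNat, Nat.add_one_sub_one, pow_one]
    congr 1
    rw [mul_assoc, mul_assoc, mul_div_mul_left _ _ two_ne_zero, mul_div_mul_left _ _ two_ne_zero]
    ring
  -- The tilt contributes `c x / σ + d y / τ` and the normalising factor `-c a / σ - d b / τ`.
  -- Together these are the factors that integration by parts produces from `φx` and `φy`.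
  refine (hq.mul (h.hasDerivAt m n c d t).2).congr_deriv ?_
  set a := m + t * c
  set b := n + t * d
  have hsum : ∫ p, φ p * (((c * (p.1 / σ) + d * (p.2 / τ) : ℝ) : ℂ) * tilt σ τ a b p)
      ∂(gauss₂ σ τ) = c * ∫ p, φ p * ((p.1 / σ : ℝ) * tilt σ τ a b p) ∂(gauss₂ σ τ) +
        d * ∫ p, φ p * ((p.2 / τ : ℝ) * tilt σ τ a b p) ∂(gauss₂ σ τ) := by
    rw [← integral_const_mul, ← integral_const_mul,
      ← integral_add ((h.fst_mul a b).const_mul _) ((h.snd_mul a b).const_mul _)]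
    refine integral_congr_ae (Eventually.of_forall fun p => ?_)
    simp only
    push_cast
    ring
  -- If `σ = 0` the first marginal is a point mass and cannot be integrated by parts, but then `c =
  -- 0`.
  have e1 : (c : ℂ) * ∫ p, φx p * tilt σ τ a b p ∂(gauss₂ σ τ) =
      c * (∫ p, φ p * ((p.1 / σ : ℝ) * tilt σ τ a b p) ∂(gauss₂ σ τ) -
        a / σ * ∫ p, φ p * tilt σ τ a b p ∂(gauss₂ σ τ)) := by
    by_cases hσ : σ = 0
    · simp [hc hσ]
    · rw [h.ibp_fst hσ hx hφx]
  have e2 : (d : ℂ) * ∫ p, φy p * tilt σ τ a b p ∂(gauss₂ σ τ) =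
      d * (∫ p, φ p * ((p.2 / τ : ℝ) * tilt σ τ a b p) ∂(gauss₂ σ τ) -
        b / τ * ∫ p, φ p * tilt σ τ a b p ∂(gauss₂ σ τ)) := by
    by_cases hτ : τ = 0
    · simp [hd hτ]
    · rw [h.ibp_snd hτ hy hφy]
  rw [hsum, mul_left_comm (c : ℂ), mul_left_comm (d : ℂ), e1, e2]
  ring

/-- The characteristic function of a Gaussian measure with complex mean. -/
theorem integral_char_mul_shift (σ : ℝ≥0) (m : ℂ) (hm : σ = 0 → m = 0) (u : ℝ) :
    ∫ x : ℝ, Complex.exp (Complex.I * (u * x : ℝ)) * Complex.exp (m * (x / σ : ℝ))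
      ∂(gaussianReal 0 σ) =
      Complex.exp (m ^ 2 / (2 * σ)) * Complex.exp (-(σ * u ^ 2) / 2 + Complex.I * u * m) := by
  have h := complexMGF_id_gaussianReal (μ := 0) (v := σ) (Complex.I * u + m / σ)
  simp only [complexMGF, id] at h
  calc _ = ∫ x : ℝ, Complex.exp ((Complex.I * u + m / σ) * x) ∂(gaussianReal 0 σ) := by
        refine integral_congr_ae (Eventually.of_forall fun x => ?_)
        simp only [← Complex.exp_add]
        congr 1
        push_cast
        ring
    _ = _ := by
        rw [h, ← Complex.exp_add]
        congr 1
        -- For `σ = 0` the integral over the point mass is 1, so the factor `exp (i u m)` on the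
        -- right must be trivial; `hm` ensures this.
        by_cases hσ : σ = 0
        · simp [hσ, hm hσ]
        · have hσc : (σ : ℂ) ≠ 0 := by exact_mod_cast hσ
          push_cast
          field_simp
          ring_nf
          simp only [Complex.I_sq]
          ring

end Gaussian

/-! ### Matrix elements of quantized symbols -/

section Quantization

open Filter Topology MeasureTheory ProbabilityTheory
open scoped NNReal

variable {𝔥 : Type u} [NormedAddCommGroup 𝔥] [InnerProductSpace ℝ 𝔥]

theorem Cplx.inner_def (x y : Cplx 𝔥) : inner ℂ x y =
    ⟨inner ℝ x.re y.re + inner ℝ x.im y.im, inner ℝ x.re y.im - inner ℝ x.im y.re⟩ := rfl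

theorem Cplx.inner_ofReal (a b : 𝔥) :
    inner ℂ (Cplx.ofReal a) (Cplx.ofReal b) = (inner ℝ a b : ℂ) := by
  simp [Cplx.inner_def, Cplx.ofReal, Complex.ext_iff]

theorem Cplx.eq_add (a b : 𝔥) :
    (⟨a, b⟩ : Cplx 𝔥) = Cplx.ofReal a + Complex.I • Cplx.ofReal b := by
  ext <;> simp [Cplx.ofReal]

theorem Cplx.ofReal_smul (r : ℝ) (a : 𝔥) :
    Cplx.ofReal (r • a) = (r : ℂ) • Cplx.ofReal a := by
  ext <;> simp only [Cplx.ofReal, Cplx.smul_re, Cplx.smul_im, Complex.ofReal_re, Complex.ofReal_im,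
    smul_zero, zero_smul, sub_zero, add_zero]

/-- The first component of the complex mean of the inverse Fourier transform of `weylMatrix`. -/
def weylMean₁ (h : 𝔥) (k₁ k₂ : Cplx 𝔥) : ℂ :=
  -Complex.I * (inner ℂ k₁ (Cplx.ofReal h) - inner ℂ (Cplx.ofReal h) k₂)

/-- The second component of the complex mean of the inverse Fourier transform of `weylMatrix`. -/
def weylMean₂ (h : 𝔥) (k₁ k₂ : Cplx 𝔥) : ℂ :=
  inner ℂ k₁ (Cplx.ofReal h) + inner ℂ (Cplx.ofReal h) k₂

/-- The exponent has no `u v` term, since `‖u h₁ + i v h₂‖² = u² ‖h₁‖² + v² ‖h₂‖²` even if `h₁`,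
`h₂` are not orthogonal. Up to the factor `exp ⟪k₁, k₂⟫` the result is a product of two Gaussian
characteristic functions with complex means. -/
theorem weylMatrix_eq (h₁ h₂ : 𝔥) (k₁ k₂ : Cplx 𝔥) (u v : ℝ) :
    weylMatrix h₁ h₂ k₁ k₂ u v = Complex.exp (inner ℂ k₁ k₂) *
      (Complex.exp (-((‖h₁‖₊ ^ 2 : ℝ≥0) * u ^ 2) / 2 + Complex.I * u * weylMean₁ h₁ k₁ k₂) *
        Complex.exp (-((‖h₂‖₊ ^ 2 : ℝ≥0) * v ^ 2) / 2 + Complex.I * v * weylMean₂ h₂ k₁ k₂)) := by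
  set z : Cplx 𝔥 := ⟨u • h₁, v • h₂⟩ with hz
  have hz' : z = (u : ℂ) • Cplx.ofReal h₁ + Complex.I • (v : ℂ) • Cplx.ofReal h₂ := by
    rw [hz, Cplx.eq_add, Cplx.ofReal_smul, Cplx.ofReal_smul]
  have hnorm : (‖z‖ : ℂ) ^ 2 = (‖h₁‖ : ℂ) ^ 2 * u ^ 2 + (‖h₂‖ : ℂ) ^ 2 * v ^ 2 := by
    have := inner_self_eq_norm_sq_to_K (𝕜 := ℂ) z
    simp only [Complex.coe_algebraMap] at this
    rw [← this, Cplx.inner_def]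
    apply Complex.ext
    · simp only [hz, real_inner_self_eq_norm_sq, norm_smul, mul_pow, Real.norm_eq_abs, sq_abs]
      norm_cast
      ring
    · simp only [hz, real_inner_smul_left, real_inner_smul_right, real_inner_comm h₁ h₂]
      norm_cast
      ring
  rw [weylMatrix, weylU, weylExp, inner_smul_right, inner_expVec, ← Complex.exp_add,
    ← Complex.exp_add, ← Complex.exp_add]
  congr 1
  rw [← hz, hnorm]
  simp only [hz', inner_add_left, inner_add_right, inner_smul_left, inner_smul_right,
    Complex.conj_ofReal, Complex.conj_I, weylMean₁, weylMean₂]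
  push_cast
  ring_nf
  simp only [Complex.I_sq]
  ring

/-- The density of the inverse Fourier transform of `weylMatrix` with respect to a Gaussian
measure. -/
def weylDensity (h₁ h₂ : 𝔥) (k₁ k₂ : Cplx 𝔥) (p : ℝ × ℝ) : ℂ :=
  Complex.exp (inner ℂ k₁ k₂) * shiftDensity (‖h₁‖₊ ^ 2) (‖h₂‖₊ ^ 2) (weylMean₁ h₁ k₁ k₂)
    (weylMean₂ h₂ k₁ k₂) p

set_option linter.unusedSectionVars false in
theorem ofReal_eq_zero_of_nnnorm {h : 𝔥} (hh : ‖h‖₊ ^ 2 = 0) : Cplx.ofReal h = 0 := by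
  have : h = 0 := by simpa using hh
  subst this
  rfl

theorem weylMean₁_eq_zero {h : 𝔥} (hh : ‖h‖₊ ^ 2 = 0) (k₁ k₂ : Cplx 𝔥) : weylMean₁ h k₁ k₂ = 0 := by
  simp [weylMean₁, ofReal_eq_zero_of_nnnorm hh]

theorem weylMean₂_eq_zero {h : 𝔥} (hh : ‖h‖₊ ^ 2 = 0) (k₁ k₂ : Cplx 𝔥) : weylMean₂ h k₁ k₂ = 0 := by
  simp [weylMean₂, ofReal_eq_zero_of_nnnorm hh]

theorem tiltIntegrable_one (σ τ : ℝ≥0) : TiltIntegrable σ τ fun _ => 1 := by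
  intro a b
  have h1 : Integrable (fun x : ℝ => Complex.exp (a * (x / σ : ℝ))) (gaussianReal 0 σ) := by
    have := (integrable_exp_mul_gaussianReal (μ := 0) (v := σ) (a / σ)).ofReal (𝕜 := ℂ)
    refine this.congr (Eventually.of_forall fun x => ?_)
    simp only [Complex.coe_algebraMap, Complex.ofReal_exp]
    congr 1
    push_cast
    ring
  have h2 : Integrable (fun x : ℝ => Complex.exp (b * (x / τ : ℝ))) (gaussianReal 0 τ) := by
    have := (integrable_exp_mul_gaussianReal (μ := 0) (v := τ) (b / τ)).ofReal (𝕜 := ℂ)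
    refine this.congr (Eventually.of_forall fun x => ?_)
    simp only [Complex.coe_algebraMap, Complex.ofReal_exp]
    congr 1
    push_cast
    ring
  refine (h1.mul_prod h2).congr (Eventually.of_forall fun p => ?_)
  simp only [tilt_eq_mul, one_mul]
  ring

/-- All these complex measures have densities with respect to one centred Gaussian that does not
depend on `k₁`, `k₂`. -/
theorem isInverseFourier_weylDensity (h₁ h₂ : 𝔥) (k₁ k₂ : Cplx 𝔥) :
    IsInverseFourier h₁ h₂ k₁ k₂ (gauss₂ (‖h₁‖₊ ^ 2) (‖h₂‖₊ ^ 2)) (weylDensity h₁ h₂ k₁ k₂) := by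
  constructor
  · have := (tiltIntegrable_one (‖h₁‖₊ ^ 2) (‖h₂‖₊ ^ 2)).complex (weylMean₁ h₁ k₁ k₂)
      (weylMean₂ h₂ k₁ k₂)
    simp only [one_mul] at this
    exact (this.const_mul _).const_mul _
  · intro u v
    rw [weylMatrix_eq]
    set m := weylMean₁ h₁ k₁ k₂ with hm
    set n := weylMean₂ h₂ k₁ k₂ with hn
    set σ := ‖h₁‖₊ ^ 2 with hσ
    set τ := ‖h₂‖₊ ^ 2 with hτ
    have e : ∀ p : ℝ × ℝ, Complex.exp (Complex.I * ((u * p.1 + v * p.2 : ℝ) : ℂ)) *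
        weylDensity h₁ h₂ k₁ k₂ p = Complex.exp (inner ℂ k₁ k₂) *
          Complex.exp (-(m ^ 2 / (2 * σ)) - n ^ 2 / (2 * τ)) *
          ((Complex.exp (Complex.I * (u * p.1 : ℝ)) * Complex.exp (m * (p.1 / σ : ℝ))) *
            (Complex.exp (Complex.I * (v * p.2 : ℝ)) * Complex.exp (n * (p.2 / τ : ℝ)))) := by
      intro p
      simp only [weylDensity, shiftDensity, tilt, ← Complex.exp_add, ← hm, ← hn, ← hσ, ← hτ]
      congr 1
      push_cast
      ring
    simp_rw [e]
    rw [integral_const_mul, gauss₂, integral_prod_mul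
      (fun x : ℝ => Complex.exp (Complex.I * (u * x : ℝ)) * Complex.exp (m * (x / σ : ℝ)))
      (fun y : ℝ => Complex.exp (Complex.I * (v * y : ℝ)) * Complex.exp (n * (y / τ : ℝ))),
      integral_char_mul_shift σ m (fun h => weylMean₁_eq_zero h _ _),
      integral_char_mul_shift τ n (fun h => weylMean₂_eq_zero h _ _)]
    simp only [← Complex.exp_add]
    congr 1
    ring

/-- The direction in which conjugation by Weyl operators shifts symbols by
`(⟪w₁, h₁⟫, ⟪w₂, h₂⟫)`. -/
def shiftVec (w₁ w₂ : 𝔥) : Cplx 𝔥 := ⟨(2⁻¹ : ℝ) • w₂, (-2⁻¹ : ℝ) • w₁⟩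

/-- For real `h`, the difference `⟪w, h⟫ - ⟪h, w⟫` sees only the imaginary part of `w`, and the sum
in `weylMean₂_shift` only the real part. Doubling and the factor `-i` explain the coefficients `2⁻¹`
and `-2⁻¹` of `shiftVec`. -/
theorem weylMean₁_shift (h w₁ w₂ : 𝔥) (k₁ k₂ : Cplx 𝔥) (t : ℝ) :
    weylMean₁ h (k₁ + (t : ℂ) • shiftVec w₁ w₂) (k₂ + (t : ℂ) • shiftVec w₁ w₂) =
      weylMean₁ h k₁ k₂ + t * (inner ℝ w₁ h : ℝ) := by
  have : inner ℂ (shiftVec w₁ w₂) (Cplx.ofReal h) - inner ℂ (Cplx.ofReal h) (shiftVec w₁ w₂) =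
      Complex.I * (inner ℝ w₁ h : ℝ) := by
    apply Complex.ext
    · simp [Cplx.inner_def, shiftVec, Cplx.ofReal, real_inner_smul_right, real_inner_comm]
    · simp [Cplx.inner_def, shiftVec, Cplx.ofReal, real_inner_smul_right, real_inner_comm]
      ring
  simp only [weylMean₁, inner_add_left, inner_add_right, inner_smul_left, inner_smul_right,
    Complex.conj_ofReal]
  linear_combination (-Complex.I * t) * this - (t * (inner ℝ w₁ h : ℝ) : ℂ) * Complex.I_sq

theorem weylMean₂_shift (h w₁ w₂ : 𝔥) (k₁ k₂ : Cplx 𝔥) (t : ℝ) :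
    weylMean₂ h (k₁ + (t : ℂ) • shiftVec w₁ w₂) (k₂ + (t : ℂ) • shiftVec w₁ w₂) =
      weylMean₂ h k₁ k₂ + t * (inner ℝ w₂ h : ℝ) := by
  have : inner ℂ (shiftVec w₁ w₂) (Cplx.ofReal h) + inner ℂ (Cplx.ofReal h) (shiftVec w₁ w₂) =
      (inner ℝ w₂ h : ℝ) := by
    apply Complex.ext
    · simp [Cplx.inner_def, shiftVec, Cplx.ofReal, real_inner_smul_right, real_inner_comm]
      ring
    · simp [Cplx.inner_def, shiftVec, Cplx.ofReal, real_inner_smul_right, real_inner_comm]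
  simp only [weylMean₂, inner_add_left, inner_add_right, inner_smul_left, inner_smul_right,
    Complex.conj_ofReal]
  linear_combination (t : ℂ) * this

theorem weylOp_spec {h₁ h₂ : 𝔥} {φ : ℝ × ℝ → ℂ} (hφ : φ ∈ weylDom h₁ h₂) :
    IsWeylQuantization h₁ h₂ φ (weylOp h₁ h₂ φ) := by
  rw [weylOp, dif_pos hφ]
  exact Classical.choose_spec hφ

/-- `IsWeylQuantization` admits any representation `ρ μ` of the complex measure. Uniqueness of
Fourier transforms carries both integrability and the value of the integral over to the explicit
Gaussian one. -/
theorem inner_weylOp {h₁ h₂ : 𝔥} {φ : ℝ × ℝ → ℂ} (hφ : φ ∈ weylDom h₁ h₂) (hm : Measurable φ)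
    (k₁ k₂ : Cplx 𝔥) :
    Integrable (fun p => φ p * weylDensity h₁ h₂ k₁ k₂ p) (gauss₂ (‖h₁‖₊ ^ 2) (‖h₂‖₊ ^ 2)) ∧
      inner ℂ (expVec k₁) (weylOp h₁ h₂ φ (expVec k₂)) =
        ∫ p, φ p * weylDensity h₁ h₂ k₁ k₂ p ∂(gauss₂ (‖h₁‖₊ ^ 2) (‖h₂‖₊ ^ 2)) := by
  obtain ⟨μ, ρ, hρ, hi, he⟩ := weylOp_spec hφ k₁ k₂
  have hγ := isInverseFourier_weylDensity h₁ h₂ k₁ k₂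
  have hft := fun u v => (hρ.2 u v).trans (hγ.2 u v).symm
  have hdm : Measurable (weylDensity h₁ h₂ k₁ k₂) :=
    ((continuous_tilt _ _ _ _).measurable.const_mul _).const_mul _
  have hi' := integrable_of_fourier_eq hρ.1 hγ.1 hdm hft hm hi
  exact ⟨hi', he.trans (integral_eq_of_fourier_eq hρ.1 hγ.1 hft hm hi hi')⟩

/-- Taking `k₁ = k₂` along `shiftVec` realises every real exponential tilt, so integrability for all
`k₁`, `k₂` already contains the claim. -/
theorem tiltIntegrable_of_mem_weylDom {h₁ h₂ : 𝔥} {φ : ℝ × ℝ → ℂ} (hφ : φ ∈ weylDom h₁ h₂)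
    (hm : Measurable φ) : TiltIntegrable (‖h₁‖₊ ^ 2) (‖h₂‖₊ ^ 2) φ := by
  intro a b
  -- A multiple of `h` achieves `⟪w, h⟫ = a`; if `h = 0`, the quotient by 0 is 0 and any `w` works.
  have pick : ∀ (h : 𝔥) (a : ℝ), ∃ w : 𝔥, ∀ x : ℝ,
      inner ℝ w h * (x / (‖h‖₊ ^ 2 : ℝ≥0)) = a * (x / (‖h‖₊ ^ 2 : ℝ≥0)) := by
    intro h a
    by_cases hh : h = 0
    · exact ⟨0, by simp [hh]⟩
    · refine ⟨(a / ‖h‖ ^ 2) • h, fun x => ?_⟩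
      rw [real_inner_smul_left, real_inner_self_eq_norm_sq, div_mul_cancel₀]
      exact pow_ne_zero _ (norm_ne_zero_iff.2 hh)
  obtain ⟨w₁, hw₁⟩ := pick h₁ a
  obtain ⟨w₂, hw₂⟩ := pick h₂ b
  have hi := (inner_weylOp hφ hm (0 + ((1 : ℝ) : ℂ) • shiftVec w₁ w₂)
    (0 + ((1 : ℝ) : ℂ) • shiftVec w₁ w₂)).1
  simp only [weylDensity, weylMean₁_shift, weylMean₂_shift, shiftDensity] at hi
  have ht : ∀ p, tilt (‖h₁‖₊ ^ 2) (‖h₂‖₊ ^ 2) (weylMean₁ h₁ 0 0 + (1 : ℝ) * (inner ℝ w₁ h₁ : ℝ))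
      (weylMean₂ h₂ 0 0 + (1 : ℝ) * (inner ℝ w₂ h₂ : ℝ)) p =
      tilt (‖h₁‖₊ ^ 2) (‖h₂‖₊ ^ 2) a b p := by
    intro p
    simp only [tilt, weylMean₁, weylMean₂, inner_zero_left, inner_zero_right, sub_zero, mul_zero,
      add_zero, zero_add, Complex.ofReal_one, one_mul, ← Complex.ofReal_mul, hw₁, hw₂]
  simp_rw [ht] at hi
  set C := Complex.exp (inner ℂ (0 + ((1 : ℝ) : ℂ) • shiftVec w₁ w₂)
    (0 + ((1 : ℝ) : ℂ) • shiftVec w₁ w₂))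
  set C' := Complex.exp (-((weylMean₁ h₁ 0 0 + (1 : ℝ) * (inner ℝ w₁ h₁ : ℝ)) ^ 2 /
    (2 * ((‖h₁‖₊ ^ 2 : ℝ≥0) : ℝ))) - (weylMean₂ h₂ 0 0 + (1 : ℝ) * (inner ℝ w₂ h₂ : ℝ)) ^ 2 /
      (2 * ((‖h₂‖₊ ^ 2 : ℝ≥0) : ℝ)))
  refine (hi.const_mul (C * C')⁻¹).congr (Eventually.of_forall fun p => ?_)
  have hC : C ≠ 0 := Complex.exp_ne_zero _
  have hC' : C' ≠ 0 := Complex.exp_ne_zero _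
  simp only
  field_simp

/-- Conjugation by Weyl operators shifts symbols. -/
theorem inner_weylExp_weylOp {h₁ h₂ : 𝔥} {φ : ℝ × ℝ → ℂ} (hφ : φ ∈ weylDom h₁ h₂)
    (hm : Measurable φ) (w₁ w₂ : 𝔥) (k₁ k₂ : Cplx 𝔥) (t : ℝ) :
    inner ℂ (weylExp ((t : ℂ) • shiftVec w₁ w₂) k₁)
      (weylOp h₁ h₂ φ (weylExp ((t : ℂ) • shiftVec w₁ w₂) k₂)) =
    Complex.exp (inner ℂ k₁ k₂) * ∫ p, φ p * shiftDensity (‖h₁‖₊ ^ 2) (‖h₂‖₊ ^ 2)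
      (weylMean₁ h₁ k₁ k₂ + t * (inner ℝ w₁ h₁ : ℝ)) (weylMean₂ h₂ k₁ k₂ + t * (inner ℝ w₂ h₂ : ℝ)) p
        ∂(gauss₂ (‖h₁‖₊ ^ 2) (‖h₂‖₊ ^ 2)) := by
  set w := shiftVec w₁ w₂ with hw
  rw [weylExp, weylExp, map_smul, inner_smul_left, inner_smul_right,
    (inner_weylOp hφ hm _ _).2, ← Complex.exp_conj, ← mul_assoc, ← Complex.exp_add,
    ← integral_const_mul, ← integral_const_mul]
  refine integral_congr_ae (Eventually.of_forall fun p => ?_)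
  simp only [weylDensity, hw, weylMean₁_shift, weylMean₂_shift]
  rw [← hw, mul_left_comm, ← mul_assoc (Complex.exp _) (Complex.exp _), ← Complex.exp_add,
    mul_left_comm (φ p)]
  -- As in `inner_weylExp`, the scalar factors cancel the shift in `⟪k₁ + t w, k₂ + t w⟫`, leaving
  -- `⟪k₁, k₂⟫`.
  congr 2
  simp only [map_sub, map_neg, map_div₀, Complex.conj_ofReal, map_ofNat, inner_conj_symm,
    inner_add_left, inner_add_right, inner_smul_left, inner_smul_right, norm_smul,
    Complex.norm_real, Complex.ofReal_mul, mul_pow, inner_self_eq_norm_sq_to_K,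
    Complex.coe_algebraMap, ← Complex.ofReal_pow, Real.norm_eq_abs, sq_abs, map_mul]
  push_cast
  ring

theorem IsSmoothSymbol.mem {h₁ h₂ : 𝔥} {φ : ℝ × ℝ → ℂ} (h : IsSmoothSymbol h₁ h₂ φ) :
    φ ∈ weylDom h₁ h₂ := h.2 0 0

theorem IsSmoothSymbol.dx_mem {h₁ h₂ : 𝔥} {φ : ℝ × ℝ → ℂ} (h : IsSmoothSymbol h₁ h₂ φ) :
    dx φ ∈ weylDom h₁ h₂ := h.2 1 0

theorem IsSmoothSymbol.dy_mem {h₁ h₂ : 𝔥} {φ : ℝ × ℝ → ℂ} (h : IsSmoothSymbol h₁ h₂ φ) :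
    dy φ ∈ weylDom h₁ h₂ := h.2 0 1

/-- The derivative of the conjugation of a quantized symbol by Weyl operators. -/
theorem hasDerivAt_inner_weylExp_weylOp {h₁ h₂ : 𝔥} {φ : ℝ × ℝ → ℂ} (h : IsSmoothSymbol h₁ h₂ φ)
    (w₁ w₂ : 𝔥) (k₁ k₂ : Cplx 𝔥) (t : ℝ) :
    HasDerivAt (fun t : ℝ => inner ℂ (weylExp ((t : ℂ) • shiftVec w₁ w₂) k₁)
        (weylOp h₁ h₂ φ (weylExp ((t : ℂ) • shiftVec w₁ w₂) k₂)))
      (inner ℂ (weylExp ((t : ℂ) • shiftVec w₁ w₂) k₁)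
        (((inner ℝ w₁ h₁ : ℂ) • weylOp h₁ h₂ (dx φ) + (inner ℝ w₂ h₂ : ℂ) • weylOp h₁ h₂ (dy φ))
          (weylExp ((t : ℂ) • shiftVec w₁ w₂) k₂))) t := by
  have hc : Continuous φ := h.1.continuous
  have hfd : Continuous (fderiv ℝ φ) := h.1.continuous_fderiv (by simp)
  have hmx : Measurable (dx φ) := (hfd.clm_apply continuous_const).measurable
  have hmy : Measurable (dy φ) := (hfd.clm_apply continuous_const).measurable
  have hd : ∀ p, HasFDerivAt φ (fderiv ℝ φ p) p := fun p =>
    (h.1.differentiable (by simp) p).hasFDerivAt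
  have hφx : ∀ x y, HasDerivAt (fun x => φ (x, y)) (dx φ (x, y)) x := fun x y =>
    (hd (x, y)).comp_hasDerivAt x ((hasDerivAt_id x).prodMk (hasDerivAt_const x y))
  have hφy : ∀ x y, HasDerivAt (fun y => φ (x, y)) (dy φ (x, y)) y := fun x y =>
    (hd (x, y)).comp_hasDerivAt y ((hasDerivAt_const y x).prodMk (hasDerivAt_id y))
  simp only [add_apply, smul_apply, inner_add_right,
    inner_smul_right, inner_weylExp_weylOp h.mem hc.measurable,
    inner_weylExp_weylOp h.dx_mem hmx, inner_weylExp_weylOp h.dy_mem hmy]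
  have hz : ∀ (w h : 𝔥), ‖h‖₊ ^ 2 = 0 → inner ℝ w h = 0 := by
    intro w h hh
    have : h = 0 := by simpa using hh
    simp [this]
  have := (hasDerivAt_integral_shiftDensity (tiltIntegrable_of_mem_weylDom h.mem hc.measurable)
    (tiltIntegrable_of_mem_weylDom h.dx_mem hmx) (tiltIntegrable_of_mem_weylDom h.dy_mem hmy)
    hφx hφy (weylMean₁ h₁ k₁ k₂) (weylMean₂ h₂ k₁ k₂) (inner ℝ w₁ h₁) (inner ℝ w₂ h₂)
    (hz _ _) (hz _ _) t).const_mul (Complex.exp (inner ℂ k₁ k₂))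
  refine this.congr_deriv ?_
  ring

end Quantization

/-! ### Derivatives under conjugation by Weyl operators -/

section WeylDeriv

open Filter Topology
open scoped NNReal

theorem norm_le_of_inner_le {H : Type*} [NormedAddCommGroup H] [InnerProductSpace ℂ H]
    {A : H →L[ℂ] H} {C : ℝ} (hC : 0 ≤ C) (h : ∀ ξ η, ‖inner ℂ ξ (A η)‖ ≤ C * ‖ξ‖ * ‖η‖) :
    ‖A‖ ≤ C := by
  refine A.opNorm_le_bound hC fun η => ?_
  by_cases hz : ‖A η‖ = 0
  · rw [hz]; positivity
  · have h1 := h (A η) η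
    rw [inner_self_eq_norm_sq_to_K, norm_pow] at h1
    simp only [Complex.coe_algebraMap, Complex.norm_real, norm_norm] at h1
    have h2 : ‖A η‖ * ‖A η‖ ≤ ‖A η‖ * (C * ‖η‖) := by nlinarith
    exact le_of_mul_le_mul_left h2 (lt_of_le_of_ne (norm_nonneg _) (Ne.symm hz))

/-- For uniformly bounded operators, weak convergence to zero may be checked on a dense set. -/
theorem tendsto_inner_zero_of_dense {ι H : Type*} [NormedAddCommGroup H] [InnerProductSpace ℂ H]
    {l : Filter ι} {A : ι → H →L[ℂ] H} {K : ℝ≥0} (hA : ∀ i, ‖A i‖ ≤ K) {s : Set H} (hs : Dense s)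
    (h : ∀ ξ ∈ s, ∀ η ∈ s, Tendsto (fun i => inner ℂ ξ (A i η)) l (𝓝 0)) (ξ η : H) :
    Tendsto (fun i => inner ℂ ξ (A i η)) l (𝓝 0) := by
  have step1 : ∀ ξ ∈ s, Tendsto (fun i => inner ℂ ξ (A i η)) l (𝓝 0) := by
    intro ξ hξ
    have heq : UniformEquicontinuous fun i η => inner ℂ ξ (A i η) := by
      refine LipschitzWith.uniformEquicontinuous _ (‖ξ‖₊ * K) fun i => ?_
      refine LipschitzWith.of_dist_le_mul fun x y => ?_
      rw [dist_eq_norm, dist_eq_norm, ← inner_sub_right, ← map_sub]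
      refine (norm_inner_le_norm _ _).trans ?_
      push_cast
      rw [mul_assoc]
      gcongr
      exact (A i).le_of_opNorm_le (hA i) _
    exact (heq.equicontinuous η).tendsto_of_mem_closure (f := fun _ => 0) tendsto_const_nhds
      (fun y hy => h ξ hξ y hy) (hs η)
  have heq : UniformEquicontinuous fun i ξ => inner ℂ ξ (A i η) := by
    refine LipschitzWith.uniformEquicontinuous _ (‖η‖₊ * K) fun i => ?_
    refine LipschitzWith.of_dist_le_mul fun x y => ?_
    rw [dist_eq_norm, dist_eq_norm, ← inner_sub_left]
    refine (norm_inner_le_norm _ _).trans ?_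
    rw [mul_comm]
    push_cast
    rw [mul_comm (‖η‖)]
    gcongr
    exact (A i).le_of_opNorm_le (hA i) _
  exact (heq.equicontinuous ξ).tendsto_of_mem_closure (f := fun _ => 0) tendsto_const_nhds
    step1 (hs ξ)

/-! ### Weak derivatives of conjugation by a unitary family. -/

variable {H : Type u} [NormedAddCommGroup H] [InnerProductSpace ℂ H]

/-- A family of unitary operators `V t` with `V 0 = 1` and inverses `V (-t)`. -/
structure IsUnitaryFamily (V : ℝ → H →L[ℂ] H) : Prop where
  zero : V 0 = 1
  mul_neg : ∀ t, V t * V (-t) = 1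
  neg_mul : ∀ t, V (-t) * V t = 1
  inner_left : ∀ t ξ η, inner ℂ (V t ξ) η = inner ℂ ξ (V (-t) η)
  norm_le : ∀ t, ‖V t‖ ≤ 1

/-- Conjugation by the operators `V t`. -/
def unitaryConj (V : ℝ → H →L[ℂ] H) (t : ℝ) (X : H →L[ℂ] H) : H →L[ℂ] H := V (-t) * X * V t

variable {V : ℝ → H →L[ℂ] H}

theorem IsUnitaryFamily.inner_conj (hV : IsUnitaryFamily V) (t : ℝ) (X : H →L[ℂ] H) (ξ η : H) :
    inner ℂ ξ (unitaryConj V t X η) = inner ℂ (V t ξ) (X (V t η)) := by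
  rw [hV.inner_left]
  rfl

theorem IsUnitaryFamily.conj_zero (hV : IsUnitaryFamily V) (X : H →L[ℂ] H) :
    unitaryConj V 0 X = X := by
  rw [unitaryConj, neg_zero, hV.zero, one_mul, mul_one]

theorem unitaryConj_add (t : ℝ) (X Y : H →L[ℂ] H) :
    unitaryConj V t (X + Y) = unitaryConj V t X + unitaryConj V t Y := by
  simp only [unitaryConj, mul_add, add_mul]

theorem unitaryConj_smul (t : ℝ) (c : ℂ) (X : H →L[ℂ] H) :
    unitaryConj V t (c • X) = c • unitaryConj V t X := by
  simp only [unitaryConj, mul_smul_comm, smul_mul_assoc]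

theorem IsUnitaryFamily.conj_mul (hV : IsUnitaryFamily V) (t : ℝ) (X Y : H →L[ℂ] H) :
    unitaryConj V t (X * Y) = unitaryConj V t X * unitaryConj V t Y := by
  simp only [unitaryConj]
  calc _ = V (-t) * X * 1 * Y * V t := by simp only [mul_one, mul_assoc]
    _ = _ := by rw [← hV.mul_neg t]; simp only [mul_assoc]

theorem IsUnitaryFamily.norm_conj_le (hV : IsUnitaryFamily V) (t : ℝ) (X : H →L[ℂ] H) :
    ‖unitaryConj V t X‖ ≤ ‖X‖ := by
  calc ‖unitaryConj V t X‖ ≤ ‖V (-t) * X‖ * ‖V t‖ := norm_mul_le _ _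
    _ ≤ (‖V (-t)‖ * ‖X‖) * ‖V t‖ := by gcongr; exact norm_mul_le _ _
    _ ≤ (1 * ‖X‖) * 1 := by gcongr <;> exact hV.norm_le _
    _ = ‖X‖ := by ring

/-- `Z` is the derivative at `t = 0` of `t ↦ V (-t) X (V t)` in the weak operator topology, and
this function is Lipschitz at `t = 0` in norm. -/
structure IsConjDeriv (V : ℝ → H →L[ℂ] H) (X Z : H →L[ℂ] H) : Prop where
  hasDerivAt : ∀ ξ η : H,
    HasDerivAt (fun t : ℝ => inner ℂ ξ (unitaryConj V t X η)) (inner ℂ ξ (Z η)) 0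
  lipschitz : ∃ C : ℝ, ∀ t : ℝ, ‖unitaryConj V t X - X‖ ≤ C * |t|

theorem IsConjDeriv.unique {X Z Z' : H →L[ℂ] H} (h : IsConjDeriv V X Z)
    (h' : IsConjDeriv V X Z') : Z = Z' :=
  ContinuousLinearMap.ext fun η => ext_inner_left ℂ fun ξ =>
    (h.hasDerivAt ξ η).unique (h'.hasDerivAt ξ η)

theorem IsConjDeriv.add {X Y Z T : H →L[ℂ] H} (h : IsConjDeriv V X Z)
    (h' : IsConjDeriv V Y T) : IsConjDeriv V (X + Y) (Z + T) := by
  refine ⟨fun ξ η => ?_, ?_⟩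
  · have := (h.hasDerivAt ξ η).add (h'.hasDerivAt ξ η)
    simpa only [unitaryConj_add, add_apply, inner_add_right] using! this
  · obtain ⟨C, hC⟩ := h.lipschitz
    obtain ⟨C', hC'⟩ := h'.lipschitz
    refine ⟨C + C', fun t => ?_⟩
    rw [unitaryConj_add, add_sub_add_comm, add_mul]
    exact (norm_add_le _ _).trans (add_le_add (hC t) (hC' t))

theorem IsConjDeriv.smul {X Z : H →L[ℂ] H} (h : IsConjDeriv V X Z) (c : ℂ) :
    IsConjDeriv V (c • X) (c • Z) := by
  refine ⟨fun ξ η => ?_, ?_⟩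
  · have := (h.hasDerivAt ξ η).const_mul c
    simpa only [unitaryConj_smul, smul_apply, inner_smul_right] using! this
  · obtain ⟨C, hC⟩ := h.lipschitz
    refine ⟨‖c‖ * C, fun t => ?_⟩
    rw [unitaryConj_smul, ← smul_sub, norm_smul, mul_assoc]
    exact mul_le_mul_of_nonneg_left (hC t) (norm_nonneg _)

theorem IsUnitaryFamily.isConjDeriv_one (hV : IsUnitaryFamily V) : IsConjDeriv V (1 : H →L[ℂ] H) 0 := by
  have h : ∀ t : ℝ, unitaryConj V t (1 : H →L[ℂ] H) = 1 := fun t => by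
    rw [unitaryConj, mul_one, hV.neg_mul]
  refine ⟨fun ξ η => ?_, 0, fun t => ?_⟩
  · simp only [h]
    simpa using hasDerivAt_const (0 : ℝ) (inner ℂ ξ η)
  · rw [h, sub_self, norm_zero, zero_mul]

/-- Weak differentiability alone does not give a product rule. The Lipschitz bounds in norm make the
cross term of the two increments `O(t²)`, so it does not contribute; in the remaining terms one
factor is fixed. -/
theorem IsConjDeriv.mul [CompleteSpace H] (hV : IsUnitaryFamily V) {X Y Z T : H →L[ℂ] H} (h : IsConjDeriv V X Z)
    (h' : IsConjDeriv V Y T) : IsConjDeriv V (X * Y) (X * T + Z * Y) := by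
  obtain ⟨C, hC⟩ := h.lipschitz
  obtain ⟨C', hC'⟩ := h'.lipschitz
  have hexp : ∀ t, unitaryConj V t (X * Y) = X * unitaryConj V t Y + unitaryConj V t X * Y - X * Y +
      (unitaryConj V t X - X) * (unitaryConj V t Y - Y) := by
    intro t
    rw [hV.conj_mul]
    noncomm_ring
  refine ⟨fun ξ η => ?_, ‖X‖ * C' + C * ‖Y‖ + (‖X‖ + ‖X‖) * C', fun t => ?_⟩
  · have h1 := h'.hasDerivAt (ContinuousLinearMap.adjoint X ξ) η
    have h2 := h.hasDerivAt ξ (Y η)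
    simp only [ContinuousLinearMap.adjoint_inner_left] at h1
    have h3 : HasDerivAt (fun t : ℝ =>
        inner ℂ ξ (((unitaryConj V t X - X) * (unitaryConj V t Y - Y)) η)) 0 0 := by
      have hO : (fun t : ℝ => inner ℂ ξ (((unitaryConj V t X - X) * (unitaryConj V t Y - Y)) η))
          =O[𝓝 0] fun t : ℝ => ‖t - 0‖ ^ 2 := by
        refine Asymptotics.IsBigO.of_bound (‖ξ‖ * (C * C') * ‖η‖) (Eventually.of_forall fun t => ?_)
        refine (norm_inner_le_norm _ _).trans ?_
        have h4 := ((unitaryConj V t X - X) * (unitaryConj V t Y - Y)).le_opNorm η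
        have h5 : ‖(unitaryConj V t X - X) * (unitaryConj V t Y - Y)‖ ≤ (C * |t|) * (C' * |t|) :=
          (norm_mul_le _ _).trans (mul_le_mul (hC t) (hC' t) (norm_nonneg _)
            ((norm_nonneg _).trans (hC t)))
        rw [sub_zero, norm_pow, norm_norm, Real.norm_eq_abs]
        calc _ ≤ ‖ξ‖ * (((C * |t|) * (C' * |t|)) * ‖η‖) := by gcongr; exact h4.trans (by gcongr)
          _ = _ := by ring
      simpa using (hO.hasFDerivAt one_lt_two).hasDerivAt
    have h6 := ((h1.add h2).sub_const (inner ℂ ξ (X (Y η)))).add h3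
    rw [add_zero] at h6
    simp only [add_apply, mul_apply_eq_comp, inner_add_right]
    refine h6.congr_of_eventuallyEq (Eventually.of_forall fun t => ?_)
    simp only [hexp, add_apply, sub_apply, mul_apply_eq_comp, inner_add_right,
      inner_sub_right, Pi.add_apply]
  -- The Lipschitz bound must be linear in `|t|` for all `t`, so only one increment of the cross
  -- term is estimated by `|t|` and the other by `2 ‖X‖`.
  · have hX : ‖unitaryConj V t X - X‖ ≤ ‖X‖ + ‖X‖ :=
      (norm_sub_le _ _).trans (add_le_add (hV.norm_conj_le _ _) le_rfl)
    have e : unitaryConj V t (X * Y) - X * Y = X * (unitaryConj V t Y - Y) + (unitaryConj V t X - X) * Y +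
        (unitaryConj V t X - X) * (unitaryConj V t Y - Y) := by
      rw [hexp]; noncomm_ring
    rw [e, add_mul, add_mul]
    refine norm_add₃_le.trans (add_le_add (add_le_add ?_ ?_) ?_)
    · refine (norm_mul_le _ _).trans ?_
      rw [mul_assoc]
      exact mul_le_mul_of_nonneg_left (hC' t) (norm_nonneg _)
    · refine (norm_mul_le _ _).trans ?_
      rw [mul_right_comm]
      exact mul_le_mul_of_nonneg_right (hC t) (norm_nonneg _)
    · refine (norm_mul_le _ _).trans ?_
      rw [mul_assoc]
      exact mul_le_mul hX (hC' t) (norm_nonneg _) (by positivity)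

/-- A weak derivative at all times on a total set is a derivative. -/
theorem IsConjDeriv.of_total (hV : IsUnitaryFamily V) {ι : Type*} {e : ι → H}
    (he : Dense (Submodule.span ℂ (Set.range e) : Set H)) {X Z : H →L[ℂ] H}
    (h : ∀ (i j : ι) (t : ℝ), HasDerivAt (fun t : ℝ => inner ℂ (V t (e i)) (X (V t (e j))))
      (inner ℂ (V t (e i)) (Z (V t (e j)))) t) :
    IsConjDeriv V X Z := by
  set S := Submodule.span ℂ (Set.range e) with hS
  have hdense : Dense (S : Set H) := he
  have hspan : ∀ ξ ∈ S, ∀ η ∈ S, ∀ t : ℝ, HasDerivAt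
      (fun t : ℝ => inner ℂ ξ (unitaryConj V t X η)) (inner ℂ ξ (unitaryConj V t Z η)) t := by
    intro ξ hξ η hη t
    induction hξ using Submodule.span_induction with
    | mem ξ hξ =>
      obtain ⟨k₁, rfl⟩ := hξ
      induction hη using Submodule.span_induction with
      | mem η hη =>
        obtain ⟨k₂, rfl⟩ := hη
        simpa only [hV.inner_conj] using h k₁ k₂ t
      | zero => simpa only [map_zero, inner_zero_right] using hasDerivAt_const t (0 : ℂ)
      | add x y _ _ hx hy =>
        simpa only [map_add, inner_add_right] using! hx.add hy
      | smul c x _ hx =>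
        simpa only [map_smul, inner_smul_right] using! hx.const_mul c
    | zero => simpa only [inner_zero_left] using hasDerivAt_const t (0 : ℂ)
    | add x y _ _ hx hy =>
      simpa only [inner_add_left] using! hx.add hy
    | smul c x _ hx =>
      simpa only [inner_smul_left] using! hx.const_mul (starRingEnd ℂ c)
  -- The derivative is known at every time and conjugation does not increase `‖Z‖`, so the mean
  -- value inequality applies.
  have hlip : ∀ t : ℝ, ‖unitaryConj V t X - X‖ ≤ ‖Z‖ * |t| := by
    intro t
    have hb : ∀ ξ ∈ S, ∀ η ∈ S,
        ‖inner ℂ ξ ((unitaryConj V t X - X) η)‖ ≤ (‖Z‖ * |t|) * ‖ξ‖ * ‖η‖ := by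
      intro ξ hξ η hη
      have := Convex.norm_image_sub_le_of_norm_hasDerivWithin_le (s := Set.univ)
        (C := ‖Z‖ * ‖ξ‖ * ‖η‖) (x := 0) (y := t)
        (fun s _ => (hspan ξ hξ η hη s).hasDerivWithinAt) (fun s _ => by
          refine (norm_inner_le_norm _ _).trans ?_
          have := (unitaryConj V s Z).le_of_opNorm_le (hV.norm_conj_le s Z) η
          calc _ ≤ ‖ξ‖ * (‖Z‖ * ‖η‖) := by gcongr
            _ = _ := by ring) convex_univ (Set.mem_univ _) (Set.mem_univ _)
      rw [hV.conj_zero, ← inner_sub_right, sub_zero, Real.norm_eq_abs] at this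
      calc _ ≤ _ := this
        _ = _ := by ring
    refine norm_le_of_inner_le (by positivity) fun ξ η => ?_
    refine isClosed_property2 (e := ((↑) : S → H))
      (p := fun ξ η => ‖inner ℂ ξ ((unitaryConj V t X - X) η)‖ ≤ (‖Z‖ * |t|) * ‖ξ‖ * ‖η‖)
      hdense.denseRange_val ?_ (fun a b => hb _ a.2 _ b.2) ξ η
    exact isClosed_le (by fun_prop) (by fun_prop)
  refine ⟨fun ξ η => ?_, ‖Z‖, hlip⟩
  -- By `hlip` the difference quotients minus `Z` are bounded by `2 ‖Z‖`, so weak convergence passes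
  -- from the span to all vectors.
  have key : Tendsto (fun t : ℝ => inner ℂ ξ (((t⁻¹ : ℝ) : ℂ) • (unitaryConj V t X - X) η - Z η))
      (𝓝[≠] 0) (𝓝 0) := by
    refine tendsto_inner_zero_of_dense (K := ‖Z‖₊ + ‖Z‖₊)
      (A := fun t : ℝ => ((t⁻¹ : ℝ) : ℂ) • (unitaryConj V t X - X) - Z) (fun t => ?_) hdense
      (fun ξ hξ η hη => ?_) ξ η
    · refine (norm_sub_le _ _).trans (add_le_add ?_ le_rfl)
      rw [norm_smul, Complex.norm_real, norm_inv, Real.norm_eq_abs]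
      by_cases ht : t = 0
      · simp [ht]
      · rw [inv_mul_le_iff₀ (abs_pos.2 ht), mul_comm]
        exact hlip t
    · have := hspan ξ hξ η hη 0
      rw [hasDerivAt_iff_tendsto_slope, hV.conj_zero] at this
      have := this.sub_const (inner ℂ ξ (Z η))
      rw [sub_self] at this
      refine this.congr fun t => ?_
      simp only [slope, vsub_eq_sub, sub_zero, hV.conj_zero, sub_apply, smul_apply,
        inner_sub_right, inner_smul_right, Complex.real_smul]
  rw [hasDerivAt_iff_tendsto_slope]
  have := key.add_const (inner ℂ ξ (Z η))
  rw [zero_add] at this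
  refine this.congr fun t => ?_
  simp only [slope, vsub_eq_sub, sub_zero, hV.conj_zero, sub_apply, inner_sub_right,
    inner_smul_right, Complex.real_smul, sub_add_cancel]

end WeylDeriv

/-! ### The derivation operator -/

section Derivation

open Filter Topology

/-- The unitary group `t ↦ W(t w)`. -/
def weylGroup {E : Type u} [NormedAddCommGroup E] [InnerProductSpace ℂ E] (w : E) (t : ℝ) :
    Fock E →L[ℂ] Fock E := weyl ((t : ℂ) • w)

theorem isUnitaryFamily_weylGroup {E : Type u} [NormedAddCommGroup E] [InnerProductSpace ℂ E]
    (w : E) : IsUnitaryFamily (weylGroup w) where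
  zero := by rw [weylGroup, Complex.ofReal_zero, zero_smul, weyl_zero]
  mul_neg t := weyl_mul_weyl_neg w t
  neg_mul t := weyl_neg_mul_weyl w t
  inner_left t ξ η := inner_weyl_left w t ξ η
  norm_le t := norm_weyl_le _

/-! ### Contractions of the algebraic tensor product. -/

variable {𝔥 : Type u} [NormedAddCommGroup 𝔥] [InnerProductSpace ℝ 𝔥]

/-- A vector of `𝔥 ⊗ ℝ²` as a vector of `𝔥_ℂ ⊗ ℂ²`. -/
def realPair (w₁ w₂ : 𝔥) : CplxSq 𝔥 := WithLp.toLp 2 (Cplx.ofReal w₁, Cplx.ofReal w₂)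

/-- The contraction `O ⊗ k ↦ ⟪w, k⟫ O`. -/
def contract (w : CplxSq 𝔥) : AlgModule 𝔥 →ₗ[ℂ] Op 𝔥 :=
  (TensorProduct.rid ℂ (Op 𝔥)).toLinearMap ∘ₗ
    LinearMap.lTensor (Op 𝔥) (innerSL ℂ w).toLinearMap

@[simp]
theorem contract_tmul (w : CplxSq 𝔥) (O : Op 𝔥) (k : CplxSq 𝔥) :
    contract w (O ⊗ₜ[ℂ] k) = inner ℂ w k • O := by
  simp [contract]

theorem contract_add_left (w w' : CplxSq 𝔥) (T : AlgModule 𝔥) :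
    contract (w + w') T = contract w T + contract w' T := by
  induction T using TensorProduct.induction_on with
  | zero => simp
  | tmul O k => rw [contract_tmul, contract_tmul, contract_tmul, inner_add_left, add_smul]
  | add S T hS hT => simp only [map_add, hS, hT]; abel

theorem contract_smul_left (c : ℂ) (w : CplxSq 𝔥) (T : AlgModule 𝔥) :
    contract (c • w) T = starRingEnd ℂ c • contract w T := by
  induction T using TensorProduct.induction_on with
  | zero => simp
  | tmul O k => rw [contract_tmul, contract_tmul, inner_smul_left, mul_smul]
  | add S T hS hT => simp only [map_add, hS, hT, smul_add]

theorem contract_leftMul (w : CplxSq 𝔥) (X : Op 𝔥) (T : AlgModule 𝔥) :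
    contract w (leftMul X T) = X * contract w T := by
  induction T using TensorProduct.induction_on with
  | zero => simp
  | tmul O k => simp [leftMul]
  | add S T hS hT => simp only [map_add, hS, hT, mul_add]

theorem contract_rightMul (w : CplxSq 𝔥) (X : Op 𝔥) (T : AlgModule 𝔥) :
    contract w (rightMul X T) = contract w T * X := by
  induction T using TensorProduct.induction_on with
  | zero => simp
  | tmul O k => simp [rightMul]
  | add S T hS hT => simp only [map_add, hS, hT, add_mul]

/-- The vectors of `𝔥_ℂ ⊗ ℂ²` are complex combinations of those of `𝔥 ⊗ ℝ²`. -/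
theorem exists_realPair (w : CplxSq 𝔥) :
    ∃ a b c d : 𝔥, w = realPair a b + Complex.I • realPair c d := by
  refine ⟨w.fst.re, w.snd.re, w.fst.im, w.snd.im, ?_⟩
  apply (WithLp.ofLp_injective 2)
  refine Prod.ext ?_ ?_
  · exact Cplx.eq_add _ _
  · exact Cplx.eq_add _ _

/-- An element of the algebraic tensor product is determined by its contractions. -/
theorem eq_zero_of_contract (T : AlgModule 𝔥) (h : ∀ w, contract w T = 0) : T = 0 := by
  obtain ⟨S, rfl⟩ := TensorProduct.exists_finset T
  -- Finitely many second legs occur. In an orthonormal basis of their span, the coefficients of `T`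
  -- are its contractions with the basis vectors.
  set F := Submodule.span ℂ (((fun i : Op 𝔥 × CplxSq 𝔥 => i.2) '' (S : Set (Op 𝔥 × CplxSq 𝔥))))
    with hF
  have : FiniteDimensional ℂ F :=
    FiniteDimensional.span_of_finite ℂ (S.finite_toSet.image _)
  set b := stdOrthonormalBasis ℂ F
  have hk : ∀ i ∈ S, i.2 = ∑ j, inner ℂ (b j : CplxSq 𝔥) i.2 • (b j : CplxSq 𝔥) := by
    intro i hi
    have hmem : i.2 ∈ F := Submodule.subset_span ⟨i, hi, rfl⟩
    have := congrArg (Subtype.val) (b.sum_repr' ⟨i.2, hmem⟩)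
    simp only [Submodule.coe_sum, Submodule.coe_smul, Submodule.coe_inner] at this
    exact this.symm
  have hsum : ∑ i ∈ S, i.1 ⊗ₜ[ℂ] i.2 =
      ∑ j, contract (b j : CplxSq 𝔥) (∑ i ∈ S, i.1 ⊗ₜ[ℂ] i.2) ⊗ₜ[ℂ] (b j : CplxSq 𝔥) := by
    simp only [map_sum, contract_tmul, TensorProduct.sum_tmul]
    rw [Finset.sum_comm]
    refine Finset.sum_congr rfl fun i hi => ?_
    conv_lhs => rw [hk i hi]
    simp only [TensorProduct.tmul_sum, TensorProduct.tmul_smul, TensorProduct.smul_tmul']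
  rw [hsum]
  simp only [h, TensorProduct.zero_tmul, Finset.sum_const_zero]

theorem eq_zero_of_contract_realPair (T : AlgModule 𝔥)
    (h : ∀ w₁ w₂, contract (realPair w₁ w₂) T = 0) : T = 0 := by
  refine eq_zero_of_contract T fun w => ?_
  obtain ⟨a, b, c, d, rfl⟩ := exists_realPair w
  rw [contract_add_left, contract_smul_left, h, h, smul_zero, add_zero]

/-! ### Gradients and the construction of the derivation operator. -/

/-- `T` represents the derivatives of `X` under conjugation by all Weyl operators. -/
def IsGradient (X : Op 𝔥) (T : AlgModule 𝔥) : Prop :=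
  ∀ w₁ w₂ : 𝔥, IsConjDeriv (weylGroup (shiftVec w₁ w₂)) X (contract (realPair w₁ w₂) T)

/-- This is the well-definedness of `D`: the value depends only on the operator, not on its
expression through generators. -/
theorem IsGradient.unique {X : Op 𝔥} {T T' : AlgModule 𝔥} (h : IsGradient X T)
    (h' : IsGradient X T') : T = T' := by
  rw [← sub_eq_zero]
  refine eq_zero_of_contract_realPair _ fun w₁ w₂ => ?_
  rw [map_sub, (h w₁ w₂).unique (h' w₁ w₂), sub_self]

theorem IsGradient.add {X Y : Op 𝔥} {T T' : AlgModule 𝔥} (h : IsGradient X T)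
    (h' : IsGradient Y T') : IsGradient (X + Y) (T + T') := fun w₁ w₂ => by
  rw [map_add]
  exact (h w₁ w₂).add (h' w₁ w₂)

theorem IsGradient.smul {X : Op 𝔥} {T : AlgModule 𝔥} (h : IsGradient X T) (c : ℂ) :
    IsGradient (c • X) (c • T) := fun w₁ w₂ => by
  rw [map_smul]
  exact (h w₁ w₂).smul c

theorem isGradient_one : IsGradient (1 : Op 𝔥) 0 := fun w₁ w₂ => by
  rw [map_zero]
  exact (isUnitaryFamily_weylGroup _).isConjDeriv_one

theorem IsGradient.mul {X Y : Op 𝔥} {T T' : AlgModule 𝔥} (h : IsGradient X T)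
    (h' : IsGradient Y T') : IsGradient (X * Y) (leftMul X T' + rightMul Y T) := fun w₁ w₂ => by
  rw [map_add, contract_leftMul, contract_rightMul]
  exact (h w₁ w₂).mul (isUnitaryFamily_weylGroup _) (h' w₁ w₂)

theorem isGradient_weylOp {h₁ h₂ : 𝔥} {φ : ℝ × ℝ → ℂ} (h : IsSmoothSymbol h₁ h₂ φ) :
    IsGradient (weylOp h₁ h₂ φ)
      (weylOp h₁ h₂ (dx φ) ⊗ₜ[ℂ] WithLp.toLp 2 (Cplx.ofReal h₁, 0) +
        weylOp h₁ h₂ (dy φ) ⊗ₜ[ℂ] WithLp.toLp 2 (0, Cplx.ofReal h₂)) := by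
  intro w₁ w₂
  rw [map_add, contract_tmul, contract_tmul]
  simp only [realPair, WithLp.prod_inner_apply, inner_zero_right, add_zero, zero_add,
    Cplx.inner_ofReal]
  refine IsConjDeriv.of_total (isUnitaryFamily_weylGroup _) span_expVec_dense fun k₁ k₂ t => ?_
  simp only [weylGroup, weyl_expVec]
  exact hasDerivAt_inner_weylExp_weylOp h w₁ w₂ k₁ k₂ t

/-- The graph of the derivation operator. -/
def gradientGraph (𝔥 : Type u) [NormedAddCommGroup 𝔥] [InnerProductSpace ℝ 𝔥] :
    Submodule ℂ (Op 𝔥 × AlgModule 𝔥) where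
  carrier := {p | p.1 ∈ smoothAlgebra 𝔥 ∧ IsGradient p.1 p.2}
  add_mem' := fun ha hb => ⟨add_mem ha.1 hb.1, ha.2.add hb.2⟩
  zero_mem' := ⟨zero_mem _, by simpa using (isGradient_one (𝔥 := 𝔥)).smul 0⟩
  smul_mem' := fun c _ ha => ⟨Subalgebra.smul_mem _ ha.1 c, ha.2.smul c⟩

theorem exists_isGradient {X : Op 𝔥} (hX : X ∈ smoothAlgebra 𝔥) : ∃ T, IsGradient X T := by
  refine Algebra.adjoin_induction (p := fun X _ => ∃ T, IsGradient X T) ?_ ?_ ?_ ?_ hX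
  · rintro X ⟨h₁, h₂, φ, hφ, rfl⟩
    exact ⟨_, isGradient_weylOp hφ⟩
  · intro r
    exact ⟨r • 0, by rw [Algebra.algebraMap_eq_smul_one]; exact isGradient_one.smul r⟩
  · rintro X Y _ _ ⟨T, hT⟩ ⟨T', hT'⟩
    exact ⟨_, hT.add hT'⟩
  · rintro X Y _ _ ⟨T, hT⟩ ⟨T', hT'⟩
    exact ⟨_, hT.mul hT'⟩

theorem gradientGraph_functional (x : Op 𝔥 × AlgModule 𝔥) (hx : x ∈ gradientGraph 𝔥)
    (hx' : x.1 = 0) : x.2 = 0 := by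
  have h := hx.2
  rw [hx'] at h
  exact h.unique ((gradientGraph 𝔥).zero_mem).2

/-- The derivation operator. -/
def gradient (𝔥 : Type u) [NormedAddCommGroup 𝔥] [InnerProductSpace ℝ 𝔥] :
    Op 𝔥 →ₗ.[ℂ] AlgModule 𝔥 := (gradientGraph 𝔥).toLinearPMap

theorem gradient_domain : (gradient 𝔥).domain = Subalgebra.toSubmodule (smoothAlgebra 𝔥) := by
  rw [gradient, Submodule.toLinearPMap_domain]
  ext X
  constructor
  · rintro ⟨p, hp, rfl⟩
    exact hp.1
  · intro hX
    obtain ⟨T, hT⟩ := exists_isGradient hX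
    exact ⟨(X, T), ⟨hX, hT⟩, rfl⟩

theorem isGradient_gradient (X : (gradient 𝔥).domain) : IsGradient (X : Op 𝔥) (gradient 𝔥 X) :=
  ((gradientGraph 𝔥).mem_graph_toLinearPMap gradientGraph_functional X).2

theorem isDerivationOperator_gradient : IsDerivationOperator (gradient 𝔥) where
  domain_eq := gradient_domain
  apply_weylOp h₁ h₂ φ hφ X hX := by
    have := isGradient_gradient X
    rw [hX] at this
    exact this.unique (isGradient_weylOp hφ)
  leibniz X Y Z hZ := by
    have := isGradient_gradient Z
    rw [hZ] at this
    exact this.unique ((isGradient_gradient X).mul (isGradient_gradient Y))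

/-- Induction over the generated algebra, since gradients obey the same rules as `D`. Both
uniqueness and closability of an arbitrary `D` follow from this. -/
theorem IsDerivationOperator.isGradient {D : Op 𝔥 →ₗ.[ℂ] AlgModule 𝔥} (hD : IsDerivationOperator D)
    (X : D.domain) : IsGradient (X : Op 𝔥) (D X) := by
  have hdom : ∀ {X : Op 𝔥}, X ∈ D.domain ↔ X ∈ smoothAlgebra 𝔥 := by
    intro X
    rw [hD.domain_eq, Subalgebra.mem_toSubmodule]
  obtain ⟨X, hX⟩ := X
  refine Algebra.adjoin_induction (p := fun X _ => ∀ hX : X ∈ D.domain, IsGradient X (D ⟨X, hX⟩))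
    ?_ ?_ ?_ ?_ (hdom.1 hX) hX
  · rintro X ⟨h₁, h₂, φ, hφ, rfl⟩ hX
    rw [hD.apply_weylOp h₁ h₂ φ hφ ⟨_, hX⟩ rfl]
    exact isGradient_weylOp hφ
  · intro r hX
    have h1 : (1 : Op 𝔥) ∈ D.domain := hdom.2 (one_mem _)
    -- The algebra contains the scalars; the Leibniz rule for `1 = 1 * 1` reads `D 1 = D 1 + D 1`.
    have h0 : D ⟨1, h1⟩ = 0 := by
      have := hD.leibniz ⟨1, h1⟩ ⟨1, h1⟩ ⟨1, h1⟩ (one_mul 1).symm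
      have hl : leftMul (1 : Op 𝔥) = LinearMap.id := by
        rw [leftMul, LinearMap.mulLeft_one, LinearMap.rTensor_id]
      have hr : rightMul (1 : Op 𝔥) = LinearMap.id := by
        rw [rightMul, LinearMap.mulRight_one, LinearMap.rTensor_id]
      simp only [hl, hr, LinearMap.id_apply] at this
      exact left_eq_add.1 this
    have hr : (⟨algebraMap ℂ (Op 𝔥) r, hX⟩ : D.domain) = r • ⟨1, h1⟩ :=
      Subtype.ext (Algebra.algebraMap_eq_smul_one r)
    rw [hr, D.map_smul, h0, Algebra.algebraMap_eq_smul_one]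
    exact isGradient_one.smul r
  · intro X Y hX hY ihX ihY hXY
    have e : (⟨X + Y, hXY⟩ : D.domain) = ⟨X, hdom.2 hX⟩ + ⟨Y, hdom.2 hY⟩ := rfl
    rw [e, D.map_add]
    exact (ihX _).add (ihY _)
  · intro X Y hX hY ihX ihY hXY
    rw [hD.leibniz ⟨X, hdom.2 hX⟩ ⟨Y, hdom.2 hY⟩ ⟨X * Y, hXY⟩ rfl]
    exact (ihX _).mul (ihY _)

theorem existsUnique_derivationOperator :
    ∃! D : Op 𝔥 →ₗ.[ℂ] AlgModule 𝔥, IsDerivationOperator D := by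
  refine ⟨gradient 𝔥, isDerivationOperator_gradient, fun D hD => ?_⟩
  refine LinearPMap.ext (hD.domain_eq.trans gradient_domain.symm) ?_
  intro X hX hX'
  exact (hD.isGradient ⟨X, hX⟩).unique (isGradient_gradient ⟨X, hX'⟩)

end Derivation

/-! ### Closability -/

section HilbertTensor

open Filter Topology

variable {H K : Type*} [NormedAddCommGroup H] [InnerProductSpace ℂ H] [NormedAddCommGroup K]
  [InnerProductSpace ℂ K]

theorem inner_coe_tmul (ξ η : H) (w k : K) :
    inner ℂ ((ξ ⊗ₜ[ℂ] w : H ⊗[ℂ] K) : UniformSpace.Completion (H ⊗[ℂ] K))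
      ((η ⊗ₜ[ℂ] k : H ⊗[ℂ] K) : UniformSpace.Completion (H ⊗[ℂ] K)) =
      inner ℂ ξ η * inner ℂ w k :=
  (UniformSpace.Completion.inner_coe _ _).trans (TensorProduct.inner_tmul ..)

/-- The simple tensors formed from total families are total in the Hilbert space tensor product. -/
theorem eq_zero_of_inner_tmul {ι κ : Type*} {e : ι → H} {r : κ → K}
    (he : Dense (Submodule.span ℂ (Set.range e) : Set H))
    (hr : Submodule.span ℂ (Set.range r) = ⊤) (v : UniformSpace.Completion (H ⊗[ℂ] K))
    (h : ∀ i j, inner ℂ ((e i ⊗ₜ[ℂ] r j : H ⊗[ℂ] K) : UniformSpace.Completion (H ⊗[ℂ] K)) v = 0) :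
    v = 0 := by
  set B : K → H →L[ℂ] ℂ := fun w =>
    innerSL ℂ v ∘L UniformSpace.Completion.toComplL ∘L ((TensorProduct.mkL ℂ H K).flip w)
  have hB : ∀ w ξ, B w ξ =
      inner ℂ v ((ξ ⊗ₜ[ℂ] w : H ⊗[ℂ] K) : UniformSpace.Completion (H ⊗[ℂ] K)) := fun _ _ => rfl
  have h1 : ∀ j, B (r j) = 0 := by
    intro j
    refine ContinuousLinearMap.ext_on he ?_
    rintro _ ⟨i, rfl⟩
    rw [hB, ← inner_conj_symm, h, map_zero]
    rfl
  have h2 : ∀ w, B w = 0 := by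
    intro w
    have hw : w ∈ Submodule.span ℂ (Set.range r) := hr ▸ Submodule.mem_top
    induction hw using Submodule.span_induction with
    | mem w hw => obtain ⟨j, rfl⟩ := hw; exact h1 j
    | zero => simp [B]
    | add x y _ _ hx hy =>
      have : B (x + y) = B x + B y := by simp only [B, map_add, ContinuousLinearMap.comp_add]
      rw [this, hx, hy, add_zero]
    | smul c x _ hx =>
      have : B (c • x) = c • B x := by simp only [B, map_smul, ContinuousLinearMap.comp_smul]
      rw [this, hx]
      exact smul_zero (A := H →L[ℂ] ℂ) c
  have h3 : ∀ x : H ⊗[ℂ] K, inner ℂ v (x : UniformSpace.Completion (H ⊗[ℂ] K)) = 0 := by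
    intro x
    induction x using TensorProduct.induction_on with
    | zero => rw [UniformSpace.Completion.coe_zero, inner_zero_right]
    | tmul ξ w => rw [← hB, h2]; rfl
    | add x y hx hy => rw [UniformSpace.Completion.coe_add, inner_add_right, hx, hy, add_zero]
  have h4 : ∀ x : UniformSpace.Completion (H ⊗[ℂ] K), inner ℂ v x = 0 := fun x =>
    UniformSpace.Completion.induction_on x (isClosed_eq (by fun_prop) continuous_const) h3
  exact inner_self_eq_zero.1 (h4 v)

/-- A criterion for closability in the weak operator topology. -/
theorem isClosable_of_inner_eq {ι κ : Type*} {D : (H →WOT[ℂ] H) →ₗ.[ℂ] (H →WOT[ℂ] K)} {e : ι → H}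
    {u : κ → K} (he : Dense (Submodule.span ℂ (Set.range e) : Set H))
    (hu : ∀ v, (∀ j, inner ℂ (u j) v = 0) → v = 0)
    (h : ∀ i j, ∃ a b c d : H, ∀ X : D.domain, inner ℂ (u j) (D X (e i)) =
      inner ℂ a ((X : H →WOT[ℂ] H) b) + inner ℂ c ((X : H →WOT[ℂ] H) d)) :
    D.IsClosable := by
  suffices hg : ∀ x ∈ D.graph.topologicalClosure, x.1 = 0 → x.2 = 0 from
    ⟨D.graph.topologicalClosure.toLinearPMap, (Submodule.toLinearPMap_graph_eq _ hg).symm⟩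
  intro x hx hx0
  have hzero : x.2.toCLM = 0 := by
    refine ContinuousLinearMap.ext_on he ?_
    rintro _ ⟨i, rfl⟩
    refine hu _ fun j => ?_
    obtain ⟨a, b, c, d, habcd⟩ := h i j
    -- Each side is continuous for the weak operator topologies, so the relation extends from the
    -- graph to its closure; with `x.1 = 0` it kills the matrix elements of `x.2`.
    have hcl : IsClosed {x : (H →WOT[ℂ] H) × (H →WOT[ℂ] K) |
        inner ℂ (u j) (x.2 (e i)) = inner ℂ a (x.1 b) + inner ℂ c (x.1 d)} := by
      refine isClosed_eq ?_ (Continuous.add ?_ ?_)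
      · exact (ContinuousLinearMapWOT.continuous_dual_apply (e i)
          (innerSL ℂ (u j))).comp continuous_snd
      · exact (ContinuousLinearMapWOT.continuous_dual_apply b (innerSL ℂ a)).comp continuous_fst
      · exact (ContinuousLinearMapWOT.continuous_dual_apply d (innerSL ℂ c)).comp continuous_fst
    have hmem := closure_minimal (s := (D.graph : Set _)) (fun y hy => by
      obtain ⟨z, hz1, hz2⟩ := (LinearPMap.mem_graph_iff _).1 hy
      simp only [Set.mem_ofPred_eq, ← hz1, ← hz2]
      exact habcd z) hcl hx
    simp only [Set.mem_ofPred_eq, hx0, ContinuousLinearMapWOT.zero_apply, inner_zero_right,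
      add_zero] at hmem
    exact hmem
  exact ContinuousLinearMapWOT.ext fun η => congrArg (fun A : H →L[ℂ] K => A η) hzero

/-- Product rule for `⟪V t ξ, X (V t η)⟫`: the derivative falls on the vectors, and `X` enters only
through matrix elements at vectors independent of `X`. -/
theorem IsConjDeriv.inner_eq {V : ℝ → H →L[ℂ] H} (hV : IsUnitaryFamily V) {X Z : H →L[ℂ] H}
    (h : IsConjDeriv V X Z) {ξ η a b : H} (ha : HasDerivAt (fun t => V t ξ) a 0)
    (hb : HasDerivAt (fun t => V t η) b 0) :
    inner ℂ ξ (Z η) = inner ℂ ξ (X b) + inner ℂ a (X η) := by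
  have h1 := h.hasDerivAt ξ η
  simp only [hV.inner_conj] at h1
  have h2 := ha.inner ℂ ((X.restrictScalars ℝ).hasFDerivAt.comp_hasDerivAt 0 hb)
  have h3 := h1.unique h2
  simpa only [Function.comp_apply, hV.zero, one_apply_eq_self,
    ContinuousLinearMap.coe_restrictScalars'] using h3

end HilbertTensor

/-! ### Application of the criterion to the derivation operator. -/

section Closability

variable {𝔥 : Type u} [NormedAddCommGroup 𝔥] [InnerProductSpace ℝ 𝔥]

theorem toHilbertModule_tmul (O : Op 𝔥) (k : CplxSq 𝔥) (η : FockSpace 𝔥) :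
    toHilbertModule 𝔥 (O ⊗ₜ[ℂ] k) η =
      ((O η ⊗ₜ[ℂ] k : FockSpace 𝔥 ⊗[ℂ] CplxSq 𝔥) : FockTensor 𝔥) := by
  rw [toHilbertModule, TensorProduct.lift.tmul]
  rfl

-- Pairing with simple tensors in the Hilbert module is contraction, which links the closability
-- criterion to `IsGradient`.
set_option maxHeartbeats 400000 in
theorem inner_toHilbertModule (T : AlgModule 𝔥) (ξ η : FockSpace 𝔥) (w : CplxSq 𝔥) :
    inner ℂ ((ξ ⊗ₜ[ℂ] w : FockSpace 𝔥 ⊗[ℂ] CplxSq 𝔥) : FockTensor 𝔥) (toHilbertModule 𝔥 T η) =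
      inner ℂ ξ (contract w T η) := by
  induction T using TensorProduct.induction_on with
  | zero =>
    rw [map_zero, map_zero]
    exact (inner_zero_right (𝕜 := ℂ) (E := FockTensor 𝔥) _).trans
      (inner_zero_right (𝕜 := ℂ) (E := FockSpace 𝔥) _).symm
  | tmul O k =>
    rw [toHilbertModule_tmul, contract_tmul]
    refine (inner_coe_tmul ξ (O η) w k).trans ?_
    rw [smul_apply, inner_smul_right, mul_comm]
  | add S T hS hT =>
    rw [map_add, map_add]
    refine (inner_add_right (𝕜 := ℂ) (E := FockTensor 𝔥) _ (toHilbertModule 𝔥 S η)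
      (toHilbertModule 𝔥 T η)).trans ?_
    rw [hS, hT]
    exact (inner_add_right (𝕜 := ℂ) (E := FockSpace 𝔥) _ _ _).symm

theorem span_realPair :
    Submodule.span ℂ (Set.range fun w : 𝔥 × 𝔥 => realPair w.1 w.2) = ⊤ := by
  rw [eq_top_iff]
  rintro w -
  obtain ⟨a, b, c, d, rfl⟩ := exists_realPair w
  exact add_mem (Submodule.subset_span ⟨(a, b), rfl⟩)
    (Submodule.smul_mem _ _ (Submodule.subset_span ⟨(c, d), rfl⟩))

set_option maxHeartbeats 1000000 in
theorem IsDerivationOperator.isClosable {D : Op 𝔥 →ₗ.[ℂ] AlgModule 𝔥}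
    (hD : IsDerivationOperator D) : (toWeak D).IsClosable := by
  refine isClosable_of_inner_eq (κ := Cplx 𝔥 × (𝔥 × 𝔥)) (span_expVec_dense (E := Cplx 𝔥))
    (u := fun j => ((expVec j.1 ⊗ₜ[ℂ] realPair j.2.1 j.2.2 : FockSpace 𝔥 ⊗[ℂ] CplxSq 𝔥) :
      FockTensor 𝔥)) (fun v hv => ?_) fun k₂ j => ?_
  · exact eq_zero_of_inner_tmul (span_expVec_dense (E := Cplx 𝔥)) (span_realPair (𝔥 := 𝔥)) v
      fun i j => hv (i, j)
  · obtain ⟨k₁, w₁, w₂⟩ := j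
    -- The vectors required by the criterion are the two exponential vectors and the velocities at 0
    -- of their orbits under the Weyl group.
    obtain ⟨a, ha⟩ := exists_hasDerivAt_weylExp k₁ (shiftVec w₁ w₂)
    obtain ⟨b, hb⟩ := exists_hasDerivAt_weylExp k₂ (shiftVec w₁ w₂)
    refine ⟨expVec k₁, b, a, expVec k₂, fun X => ?_⟩
    simp only [← weyl_expVec] at ha hb
    have h1 := (hD.isGradient ⟨(X : FockSpace 𝔥 →WOT[ℂ] FockSpace 𝔥).toCLM, X.2⟩) w₁ w₂
    have h2 := h1.inner_eq (isUnitaryFamily_weylGroup _) ha hb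
    exact (inner_toHilbertModule _ _ _ _).trans h2

end Closability

end QMalliavin

end

theorem mainTheorem7 (𝔥 : Type*) [NormedAddCommGroup 𝔥] [InnerProductSpace ℝ 𝔥]
    [CompleteSpace 𝔥] [TopologicalSpace.SeparableSpace 𝔥] :
    (∃! D : QMalliavin.Op 𝔥 →ₗ.[ℂ] QMalliavin.AlgModule 𝔥, QMalliavin.IsDerivationOperator D) ∧
      ∀ D : QMalliavin.Op 𝔥 →ₗ.[ℂ] QMalliavin.AlgModule 𝔥,
        QMalliavin.IsDerivationOperator D → (QMalliavin.toWeak D).IsClosable :=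
  ⟨QMalliavin.existsUnique_derivationOperator, fun _ hD => hD.isClosable⟩
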